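/- Let $K=(k_{ji})$ be an $N\times r$ matrix of non-negative integers without zero rows, put $\gamma_j(\bar x)=x_1^{k_{j1}}\cdots x_r^{k_{jr}}$ and $F(\bar x)=\sum_{j=1}^N\alpha_j\gamma_j(\bar x)$, and let $m=\max_j(k_{j1}+\cdots+k_{jr})$ be the degree of $F$. Define $$\theta_k=\int_{\mathbb R^N}\Bigl|\int_{[0,1]^r}e^{2\pi iF(\bar x)}\,d\bar x\Bigr|^{2k}d\alpha_1\cdots d\alpha_N\in[0,\infty].$$ Suppose that the rows of $K$ are strictly increasing in the order that compares first the sum of the entries and then lexicographically, that $K$ has rank $\rho\ge1$, and that $K$ has the structure $(\rho_1,\dots,\rho_q)$, that is: $K$ is cut into $q$ consecutive non-empty blocks of rows $A_1,\dots,A_q$, where $A_j$ has $\rho_j$ rows and rank $\rho_j$, joining to $A_j$ the first row of $A_{j+1}$ does not change its rank, and deleting its last row lowers its rank. Let $k\rho\ge N$ and $k\ge q$. Let $\Pi\subset[0,1]^{2kr}$ be the set of solutions of $$\gamma_j(\bar x_1)+\cdots+\gamma_j(\bar x_k)-\gamma_j(\bar x_{k+1})-\cdots-\gamma_j(\bar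 x_{2k})=0,\qquad j=1,\dots,N,$$ let $J_0$ be the $N\times 2kr$ Jacobian matrix of the left-hand sides, and let $G_0=\det(J_0\cdot{}^tJ_0)$. Let $\varphi^{(1)}$ be the $N\times kr$ Jacobian matrix of the functions $\gamma_j(\bar x_1)+\cdots+\gamma_j(\bar x_k)$, let $\varphi^{(j+1)}$ be the transposed Jacobian matrix of the system of all entries of $\varphi^{(j)}$ (its rows correspond to the $kr$ variables), and let $\Phi_j=\det(\varphi^{(j)}\cdot{}^t\varphi^{(j)})$. For a finite set $I$ of positive integers and $\lambda>0$ let $D^I_\lambda$ be the set of $(\bar x_1,\dots,\bar x_k)\in[0,1]^{kr}$ with $\Phi_j\ge\lambda$ for all $j\in I$. Then $$\theta_k=\lim_{\lambda\to0+}\int_{\Pi\cap(D^I_\lambda\times D^I_\lambda)}\frac{ds}{\sqrt{G_0}}$$ in $[0,\infty]$, where $ds$ is the $(2kr-N)$-dimensional surface measure, in each of the following cases: (a) $I=\{1\}$; (b) $I=\{1,\dots,m-1\}$, provided that every variable $x_i$ occurs in some monomial $\gamma_j$ of the highest degree $m$. In this sense $\theta_k=\int_\Pi ds/\sqrt{G_0}$.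 -/

import Mathlib

open MeasureTheory Filter Topology

namespace Terry

/-! ### The polynomial and the special integral -/

/-- `F(x) = ∑ⱼ αⱼ x₁^{kⱼ₁} ⋯ x_r^{kⱼᵣ}`, where `K` is the matrix of exponents. -/
noncomputable def phase {N r : ℕ} (K : Matrix (Fin N) (Fin r) ℕ)
    (α : Fin N → ℝ) (x : Fin r → ℝ) : ℝ :=
  ∑ j, α j * ∏ s, x s ^ K j s

/-- The special integral `θ_k`, the integral over all `α ∈ ℝ^N` of the `2k`-th power of the modulus
of the trigonometric integral over the unit cube; it takes the value `∞` when it diverges. -/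
noncomputable def theta {N r : ℕ} (K : Matrix (Fin N) (Fin r) ℕ) (k : ℕ) : ENNReal :=
  ∫⁻ α : Fin N → ℝ,
    ‖∫ x in Set.Icc (0 : Fin r → ℝ) 1,
      Complex.exp (2 * Real.pi * Complex.I * (phase K α x : ℂ))‖ₑ ^ (2 * k)

/-- The degree of `F`. -/
def degree {N r : ℕ} (K : Matrix (Fin N) (Fin r) ℕ) : ℕ :=
  Finset.univ.sup fun j => ∑ s, K j s

/-- Every variable occurs in the senior form (the homogeneous part of top degree) of `F`. -/
def SeniorFormContainsAll {N r : ℕ} (K : Matrix (Fin N) (Fin r) ℕ) : Prop :=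
  ∀ s, ∃ j, ∑ t, K j t = degree K ∧ 0 < K j s

/-! ### The order of the monomials and the structure of the matrix of exponents -/

/-- The normally-lexicographic order: by total degree, then lexicographically. -/
def nlLT {r : ℕ} (a b : Fin r → ℕ) : Prop :=
  ∑ s, a s < ∑ s, b s ∨ (∑ s, a s = ∑ s, b s ∧ toLex a < toLex b)

/-- The rows are listed in strictly increasing normally-lexicographic order. -/
def NLOrdered {N r : ℕ} (K : Matrix (Fin N) (Fin r) ℕ) : Prop :=
  ∀ i j : Fin N, i < j → nlLT (K i) (K j)

/-- The matrix of exponents as a real matrix. -/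
def realMatrix {N r : ℕ} (K : Matrix (Fin N) (Fin r) ℕ) : Matrix (Fin N) (Fin r) ℝ :=
  K.map (fun n => (n : ℝ))

/-- The rank of the block formed by the rows with (zero-based) index `i`, `a ≤ i < b`. -/
noncomputable def blockRank {N r : ℕ} (K : Matrix (Fin N) (Fin r) ℕ) (a b : ℕ) : ℕ :=
  ((realMatrix K).submatrix (fun i : {i : Fin N // a ≤ i.val ∧ i.val < b} => i.val) id).rank

/-- `K` has the structure `(ρ₁, …, ρ_q)`: it is cut into `q` consecutive non-empty blocks of rows,
the `j`-th block consists of `ρⱼ` rows and has rank `ρⱼ` (so that `ρ₁ + ⋯ + ρ_q = N`), joining to it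
the first row of the next block leaves its rank unchanged, and deleting its last row lowers its
rank. For the last block there is no row to join, and the third clause is then trivially true. -/
def HasStructure {N r q : ℕ} (K : Matrix (Fin N) (Fin r) ℕ) (ρ : Fin q → ℕ) : Prop :=
  ∃ c : Fin (q + 1) → ℕ, c 0 = 0 ∧ c (Fin.last q) = N ∧
    ∀ j : Fin q,
      c j.castSucc < c j.succ ∧
      c j.castSucc + ρ j = c j.succ ∧
      blockRank K (c j.castSucc) (c j.succ) = ρ j ∧
      blockRank K (c j.castSucc) (c j.succ + 1) = blockRank K (c j.castSucc) (c j.succ) ∧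
      blockRank K (c j.castSucc) (c j.succ - 1) < blockRank K (c j.castSucc) (c j.succ)

/-! ### The system connected with `F`, Jacobian and Gram determinants -/

/-- The monomial `γⱼ` in the `i`-th of several groups of `r` variables. -/
noncomputable def gammaAt {N r : ℕ} (K : Matrix (Fin N) (Fin r) ℕ) {ι : Type} (j : Fin N) (i : ι) :
    MvPolynomial (ι × Fin r) ℝ :=
  ∏ s, MvPolynomial.X (i, s) ^ K j s

/-- `γⱼ(x₁) + ⋯ + γⱼ(x_k)`. -/
noncomputable def halfSystem {N r : ℕ} (K : Matrix (Fin N) (Fin r) ℕ) (k : ℕ) (j : Fin N) :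
    MvPolynomial (Fin k × Fin r) ℝ :=
  ∑ i, gammaAt K j i

/-- `γⱼ(x₁) + ⋯ + γⱼ(x_k) - γⱼ(x_{k+1}) - ⋯ - γⱼ(x_{2k})`. The index `Sum.inl i` stands for the
vector `x_i` and `Sum.inr i` for the vector `x_{k+i}`. -/
noncomputable def system {N r : ℕ} (K : Matrix (Fin N) (Fin r) ℕ) (k : ℕ) (j : Fin N) :
    MvPolynomial ((Fin k ⊕ Fin k) × Fin r) ℝ :=
  ∑ i : Fin k, gammaAt K j (Sum.inl i) - ∑ i : Fin k, gammaAt K j (Sum.inr i)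

/-- The Jacobian matrix of a family of polynomials. -/
noncomputable def jacobian {ι σ : Type} (P : ι → MvPolynomial σ ℝ) :
    Matrix ι σ (MvPolynomial σ ℝ) :=
  Matrix.of fun i v => MvPolynomial.pderiv v (P i)

/-- `det (A · ᵗA)`. -/
def gramDet {m n R : Type} [Fintype m] [DecidableEq m] [Fintype n] [CommRing R]
    (A : Matrix m n R) : R :=
  (A * A.transpose).det

/-- `G₀ = det (J₀ · ᵗJ₀)`, where `J₀` is the Jacobian matrix of the system. -/
noncomputable def G0 {N r : ℕ} (K : Matrix (Fin N) (Fin r) ℕ) (k : ℕ) :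
    MvPolynomial ((Fin k ⊕ Fin k) × Fin r) ℝ :=
  gramDet (jacobian (system K k))

/-- The iterated partial derivative `∂_{β 0} ⋯ ∂_{β (l-1)} f`. -/
noncomputable def iterPderiv {σ : Type} {l : ℕ} (β : Fin l → σ) (f : MvPolynomial σ ℝ) :
    MvPolynomial σ ℝ :=
  (List.ofFn β).foldr (fun v p => MvPolynomial.pderiv v p) f

/-- The matrix `φ^{(l+2)}`: the transposed Jacobian matrix of the family of all entries of
`φ^{(l+1)}`, these entries being the partial derivatives of order `l + 1` of the functions
`γⱼ(x₁) + ⋯ + γⱼ(x_k)`. Its rows correspond to the variables. -/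
noncomputable def phiHigher {N r : ℕ} (K : Matrix (Fin N) (Fin r) ℕ) (k l : ℕ) :
    Matrix (Fin k × Fin r) (Fin N × (Fin (l + 1) → Fin k × Fin r))
      (MvPolynomial (Fin k × Fin r) ℝ) :=
  (jacobian fun e : Fin N × (Fin (l + 1) → Fin k × Fin r) =>
    iterPderiv e.2 (halfSystem K k e.1)).transpose

/-- `Φⱼ = det (φ^{(j)} · ᵗφ^{(j)})` for `j ≥ 1`, where `φ^{(1)}` is the Jacobian matrix of
`(x₁, …, x_k) ↦ (γⱼ(x₁) + ⋯ + γⱼ(x_k))ⱼ`. The index `0` is not used. -/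
noncomputable def Phi {N r : ℕ} (K : Matrix (Fin N) (Fin r) ℕ) (k : ℕ) :
    ℕ → MvPolynomial (Fin k × Fin r) ℝ
  | 0 => 1
  | 1 => gramDet (jacobian (halfSystem K k))
  | l + 2 => gramDet (phiHigher K k l)

/-! ### The surface integral -/

/-- The points of the cube `[0,1]^{kr}` at which `Φⱼ ≥ lam` for all `j` in `J`. -/
def D {N r : ℕ} (K : Matrix (Fin N) (Fin r) ℕ) (k : ℕ) (J : Finset ℕ) (lam : ℝ) :
    Set (Fin k × Fin r → ℝ) :=
  {x | x ∈ Set.Icc 0 1 ∧ ∀ j ∈ J, lam ≤ MvPolynomial.eval x (Phi K k j)}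

/-- The algebraic set `Π` in the `2kr`-dimensional unit cube (with the Euclidean metric). -/
def PiSet {N r : ℕ} (K : Matrix (Fin N) (Fin r) ℕ) (k : ℕ) :
    Set (EuclideanSpace ℝ ((Fin k ⊕ Fin k) × Fin r)) :=
  {z | (∀ p, z p ∈ Set.Icc (0 : ℝ) 1) ∧
    ∀ j, MvPolynomial.eval (fun p => z p) (system K k j) = 0}

/-- `D × D` as a set of points of the `2kr`-dimensional space. -/
def DProd {N r : ℕ} (K : Matrix (Fin N) (Fin r) ℕ) (k : ℕ) (J : Finset ℕ) (lam : ℝ) :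
    Set (EuclideanSpace ℝ ((Fin k ⊕ Fin k) × Fin r)) :=
  {z | (fun p : Fin k × Fin r => z (Sum.inl p.1, p.2)) ∈ D K k J lam ∧
    (fun p : Fin k × Fin r => z (Sum.inr p.1, p.2)) ∈ D K k J lam}

/-- The surface integral of `1 / √G₀` over `Π ∩ (D × D)`; the element `ds` is that of the
`(2kr - N)`-dimensional Euclidean surface measure. -/
noncomputable def surfaceIntegral {N r : ℕ} (K : Matrix (Fin N) (Fin r) ℕ) (k : ℕ)
    (J : Finset ℕ) (lam : ℝ) : ENNReal :=
  ∫⁻ z in PiSet K k ∩ DProd K k J lam,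
    ENNReal.ofReal (1 / √(MvPolynomial.eval (fun p => z p) (G0 K k)))
      ∂(Measure.euclideanHausdorffMeasure (2 * k * r - N))

end Terry

/-! Let φ : ℝ^{kr} → ℝ^N have the components γ_j(x̄_1)+…+γ_j(x̄_k). By Fubini, the k-th power of the
trigonometric integral is ∫ e^{2πi α·φ(x)} dx over the cube [0,1]^{kr}. This is the Fourier
transform, at −α, of the image under φ of Lebesgue measure on the cube. If that image has a density
f, Plancherel gives θ_k = ∫ f², whether finite or not (`theta_eq_lintegral_sq`).

Where Φ_1 ≠ 0 the map φ is a submersion, and (φ, L), with L a suitable linear map, is a local chart.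
In the chart f(t) is the integral of |det|⁻¹ over the free coordinates v. Moreover ∫ f² = ∫ f(φ(x))
dx, and (x, v) parametrizes the surface φ(x) = φ(y). A determinant identity
(`sqrt_det_mul_one_div_sqrt_det`) shows that the surface Jacobian divided by √G₀ is exactly |det|⁻¹.
Hence ∫ f² is the integral of 1/√G₀ over that surface (`exists_density_lintegral_fiberProduct`).

This applies to any measurable part of the cube on which Φ_1 ≠ 0, and a part of full measure yields
the same f up to null sets. As λ decreases to 0 the sets D^I_λ exhaust the set where all Φ_j, j ∈ I,
are positive. That set has full measure once these polynomials are nonzero, and monotone convergence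
gives the limit.

It remains to see that the polynomials do not vanish identically. For Φ_1 (`Phi_one_ne_zero`), put
x_{i,s} = T_i^{2w_s} with weights w for which the monomials become powers of T_i with strictly
increasing exponents. The rows inside a block are independent, and sufficiently small parameters,
chosen successively, separate the blocks; q ≤ k provides a group of variables for each block. For
the higher Φ_j (`Phi_higher_ne_zero`), evaluate at (1,…,1): an Euler relation for the monomials of
top degree excludes a kernel vector. -/

namespace Terry

/-! ### Area formula for Euclidean Hausdorff measure -/

section AreaFormula

open Module Set
open scoped NNReal ENNReal

/-- On `s` the map `f` factors through `g` by a `C`-Lipschitz map of `g '' s`. Applied in both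
directions, this compares a nonlinear map with its derivative. -/
theorem euclideanHausdorffMeasure_image_le_image {X Y Z : Type*} [Nonempty X]
    [EMetricSpace Y] [MeasurableSpace Y] [BorelSpace Y]
    [EMetricSpace Z] [MeasurableSpace Z] [BorelSpace Z] {f : X → Y} {g : X → Z} {C : ℝ≥0}
    {s : Set X} (d : ℕ)
    (h : ∀ x ∈ s, ∀ y ∈ s, edist (f x) (f y) ≤ C * edist (g x) (g y)) :
    μHE[d] (f '' s) ≤ (C : ℝ≥0∞) ^ d * μHE[d] (g '' s) := by
  set u : Z → Y := fun z => f (Function.invFunOn g s z) with hu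
  -- The Lipschitz bound makes `f` constant on the fibers of `g` in `s`, so the chosen preimage is
  -- immaterial.
  have key : ∀ x ∈ s, u (g x) = f x := by
    intro x hx
    have h1 : Function.invFunOn g s (g x) ∈ s := Function.invFunOn_mem ⟨x, hx, rfl⟩
    have h2 : g (Function.invFunOn g s (g x)) = g x := Function.invFunOn_eq ⟨x, hx, rfl⟩
    have h3 := h _ h1 _ hx
    rw [h2, edist_self, mul_zero, nonpos_iff_eq_zero, edist_eq_zero] at h3
    exact h3
  have hL : LipschitzOnWith C u (g '' s) := by
    rintro _ ⟨x, hx, rfl⟩ _ ⟨y, hy, rfl⟩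
    rw [key x hx, key y hy]
    exact h x hx y hy
  have himg : u '' (g '' s) = f '' s := by
    rw [Set.image_image]
    exact Set.image_congr key
  have := hL.hausdorffMeasure_image_le (d := d) (by positivity)
  rw [himg, ENNReal.rpow_natCast] at this
  simp only [Measure.euclideanHausdorffMeasure_def, Measure.smul_apply, ENNReal.smul_def,
    smul_eq_mul]
  calc _ ≤ _ := mul_le_mul_right this _
    _ = _ := by ring

variable {U F : Type*} [NormedAddCommGroup U] [InnerProductSpace ℝ U] [FiniteDimensional ℝ U]
  [NormedAddCommGroup F] [InnerProductSpace ℝ F]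

/-- Strict differentiability bounds the linearization error by a small multiple of ‖y − z‖. Since
`A` is injective on a finite-dimensional space, this is a small multiple of ‖A(y − z)‖. -/
theorem exists_nhds_bilipschitz {f : U → F} {A : U →L[ℝ] F} {x : U}
    (hf : HasStrictFDerivAt f A x) (hA : Function.Injective A) {c : ℝ≥0} (hc : 1 < c) :
    ∃ V : Set U, IsOpen V ∧ x ∈ V ∧ ∀ y ∈ V, ∀ z ∈ V,
      edist (f y) (f z) ≤ c * edist (A y) (A z) ∧ edist (A y) (A z) ≤ c * edist (f y) (f z) := by
  obtain ⟨K, hK, hAK⟩ := A.toLinearMap.exists_antilipschitzWith (LinearMap.ker_eq_bot.2 hA)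
  have hc' : (1 : ℝ) < c := by exact_mod_cast hc
  have hK' : (0 : ℝ) < K := by exact_mod_cast hK
  -- With ε K = 1 − 1/c the lower constant is exactly 1/c, and the upper one, 2 − 1/c, is at most c
  -- because (c − 1)² ≥ 0.
  set ε : ℝ := (1 - (c : ℝ)⁻¹) / K with hε
  have hci : (c : ℝ)⁻¹ < 1 := inv_lt_one_of_one_lt₀ hc'
  have hεpos : 0 < ε := div_pos (by linarith) hK'
  have hlit := hf.isLittleO.def hεpos
  rw [nhds_prod_eq] at hlit
  obtain ⟨V, hV, hVV⟩ := Filter.mem_prod_same_iff.1 hlit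
  obtain ⟨W, hWV, hWo, hxW⟩ := mem_nhds_iff.1 hV
  refine ⟨W, hWo, hxW, fun y hy z hz => ?_⟩
  have h1 : ‖f y - f z - A (y - z)‖ ≤ ε * ‖y - z‖ :=
    hVV (Set.mk_mem_prod (hWV hy) (hWV hz))
  have h2 : ‖y - z‖ ≤ K * ‖A (y - z)‖ := by
    have := hAK.le_mul_dist y z
    simpa [dist_eq_norm, ← map_sub] using this
  have h3 : ‖f y - f z - A (y - z)‖ ≤ (1 - (c : ℝ)⁻¹) * ‖A (y - z)‖ := by
    refine h1.trans ((mul_le_mul_of_nonneg_left h2 hεpos.le).trans_eq ?_)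
    rw [hε]; field_simp
  have hn := norm_nonneg (A (y - z))
  have h4 : ‖f y - f z‖ ≤ (1 + (1 - (c : ℝ)⁻¹)) * ‖A (y - z)‖ := by
    have := norm_sub_norm_le (f y - f z) (A (y - z))
    linarith
  have h5 : (c : ℝ)⁻¹ * ‖A (y - z)‖ ≤ ‖f y - f z‖ := by
    have := norm_sub_norm_le (A (y - z)) (f y - f z)
    rw [norm_sub_rev (A (y - z))] at this
    linarith
  have h6 : 1 + (1 - (c : ℝ)⁻¹) ≤ c := by
    have : (c : ℝ) * (c : ℝ)⁻¹ = 1 := mul_inv_cancel₀ (by positivity)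
    nlinarith [sq_nonneg ((c : ℝ) - 1)]
  have e1 : ∀ u v : F, edist u v = ENNReal.ofReal ‖u - v‖ := fun u v => by
    rw [edist_dist, dist_eq_norm]
  have e2 : (c : ℝ≥0∞) = ENNReal.ofReal c := by simp
  rw [e1, e1, ← map_sub, e2, ← ENNReal.ofReal_mul (by positivity),
    ← ENNReal.ofReal_mul (by positivity)]
  constructor
  · exact ENNReal.ofReal_le_ofReal (h4.trans (mul_le_mul_of_nonneg_right h6 hn))
  · refine ENNReal.ofReal_le_ofReal ?_
    rw [inv_mul_le_iff₀ (by positivity)] at h5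
    exact h5

variable [FiniteDimensional ℝ F]

theorem continuous_normDet :
    Continuous fun A : U →L[ℝ] F => A.toLinearMap.normDet := by
  have : (fun A : U →L[ℝ] F => A.toLinearMap.normDet) =
      fun A : U →L[ℝ] F => √((ContinuousLinearMap.adjoint A ∘L A).det) := by
    ext A
    rw [← A.normDet_sq]
    simp [Real.sqrt_sq (LinearMap.normDet_nonneg _)]
  rw [this]
  refine Real.continuous_sqrt.comp (ContinuousLinearMap.continuous_det.comp ?_)
  exact (ContinuousLinearMap.adjoint (𝕜 := ℝ) (E := U) (F := F)).continuous.clm_comp continuous_id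

variable [MeasurableSpace U] [BorelSpace U] [MeasurableSpace F] [BorelSpace F]

/-- The exponent collects one factor `c` per dimension from the bilipschitz comparison and one more
from the oscillation of the Jacobian near `x`. -/
theorem exists_nhds_lintegral_normDet_comparable {f : U → F} {f' : U → U →L[ℝ] F} {s : Set U}
    (hf : ∀ x ∈ s, HasStrictFDerivAt f (f' x) x) (hf'c : ContinuousOn f' s)
    (hinj : ∀ x ∈ s, Function.Injective (f' x)) {c : ℝ≥0} (hc : 1 < c) {x : U} (hx : x ∈ s) :
    ∃ V : Set U, IsOpen V ∧ x ∈ V ∧ ∀ t ⊆ V ∩ s, MeasurableSet t →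
      μHE[finrank ℝ U] (f '' t) ≤ (c : ℝ≥0∞) ^ (finrank ℝ U + 1) *
        ∫⁻ y in t, ENNReal.ofReal (f' y).toLinearMap.normDet ∧
      ∫⁻ y in t, ENNReal.ofReal (f' y).toLinearMap.normDet ≤
        (c : ℝ≥0∞) ^ (finrank ℝ U + 1) * μHE[finrank ℝ U] (f '' t) := by
  obtain ⟨V, hVo, hxV, hV⟩ := exists_nhds_bilipschitz (hf x hx) (hinj x hx) hc
  have hJ : ContinuousOn (fun y => (f' y).toLinearMap.normDet) s :=
    continuous_normDet.comp_continuousOn hf'c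
  set J : ℝ := (f' x).toLinearMap.normDet with hJdef
  have hJ0 : 0 < J := by
    refine lt_of_le_of_ne (LinearMap.normDet_nonneg _) (Ne.symm ?_)
    intro h0
    rw [hJdef, LinearMap.normDet_eq_zero_iff_ker_ne_bot] at h0
    exact h0 (LinearMap.ker_eq_bot.2 (hinj x hx))
  have hc' : (1 : ℝ) < c := by exact_mod_cast hc
  have hcpos : (0 : ℝ) < c := by linarith
  have hnear : ∀ᶠ y in 𝓝[s] x, (f' y).toLinearMap.normDet ∈ Ioo ((c : ℝ)⁻¹ * J) (c * J) := by
    refine (hJ x hx) (Ioo_mem_nhds ?_ ?_)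
    · have := inv_lt_one_of_one_lt₀ hc'
      change (c : ℝ)⁻¹ * J < J
      nlinarith
    · change J < c * J
      nlinarith
  obtain ⟨W, hWo, hxW, hW⟩ := mem_nhdsWithin.1 hnear
  refine ⟨V ∩ W, hVo.inter hWo, ⟨hxV, hxW⟩, fun t ht htm => ?_⟩
  have hA := LinearMap.euclideanHausdorffMeasure_image_eq_normDet_mul_volume
    (f' x).toLinearMap t
  have i1 : μHE[finrank ℝ U] (f '' t) ≤ (c : ℝ≥0∞) ^ finrank ℝ U *
      μHE[finrank ℝ U] ((f' x).toLinearMap '' t) :=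
    euclideanHausdorffMeasure_image_le_image _
      fun y hy z hz => (hV y (ht hy).1.1 z (ht hz).1.1).1
  have i2 : μHE[finrank ℝ U] ((f' x).toLinearMap '' t) ≤ (c : ℝ≥0∞) ^ finrank ℝ U *
      μHE[finrank ℝ U] (f '' t) :=
    euclideanHausdorffMeasure_image_le_image _
      fun y hy z hz => (hV y (ht hy).1.1 z (ht hz).1.1).2
  rw [hA] at i1 i2
  have e2 : (c : ℝ≥0∞) = ENNReal.ofReal c := by simp
  have j1 : ENNReal.ofReal J * volume t ≤
      c * ∫⁻ y in t, ENNReal.ofReal (f' y).toLinearMap.normDet := by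
    rw [← lintegral_const_mul' _ _ ENNReal.coe_ne_top, ← setLIntegral_const]
    refine setLIntegral_mono' htm fun y hy => ?_
    rw [e2, ← ENNReal.ofReal_mul hcpos.le]
    refine ENNReal.ofReal_le_ofReal ?_
    have := (hW ⟨(ht hy).1.2, (ht hy).2⟩).1
    rw [inv_mul_lt_iff₀ hcpos] at this
    exact this.le
  have j2 : ∫⁻ y in t, ENNReal.ofReal (f' y).toLinearMap.normDet ≤
      c * (ENNReal.ofReal J * volume t) := by
    rw [← mul_assoc, ← setLIntegral_const]
    refine setLIntegral_mono' htm fun y hy => ?_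
    rw [e2, ← ENNReal.ofReal_mul hcpos.le]
    exact ENNReal.ofReal_le_ofReal (hW ⟨(ht hy).1.2, (ht hy).2⟩).2.le
  constructor
  · calc _ ≤ _ := i1
      _ ≤ _ := mul_le_mul_right j1 _
      _ = _ := by ring
  · calc _ ≤ _ := j2
      _ ≤ _ := mul_le_mul_right i2 _
      _ = _ := by ring

/-- Countably many neighborhoods of comparability cover `s`. Injectivity keeps the images of
disjoint pieces disjoint, so the local estimates add up with the same constant, and then c → 1. -/
theorem lintegral_normDet_eq_image {f : U → F} {f' : U → U →L[ℝ] F} {s : Set U}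
    (hs : MeasurableSet s)
    (hf : ∀ x ∈ s, HasStrictFDerivAt f (f' x) x) (hf'c : ContinuousOn f' s)
    (hinj : ∀ x ∈ s, Function.Injective (f' x)) (hfs : InjOn f s) :
    ∫⁻ y in s, ENNReal.ofReal (f' y).toLinearMap.normDet = μHE[finrank ℝ U] (f '' s) := by
  have hcont : ContinuousOn f s := fun x hx =>
    (hf x hx).hasFDerivAt.continuousAt.continuousWithinAt
  have approx : ∀ c : ℝ≥0, 1 < c →
      μHE[finrank ℝ U] (f '' s) ≤ (c : ℝ≥0∞) ^ (finrank ℝ U + 1) *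
        ∫⁻ y in s, ENNReal.ofReal (f' y).toLinearMap.normDet ∧
      ∫⁻ y in s, ENNReal.ofReal (f' y).toLinearMap.normDet ≤
        (c : ℝ≥0∞) ^ (finrank ℝ U + 1) * μHE[finrank ℝ U] (f '' s) := by
    intro c hc
    choose! V hVo hxV hV using fun x (hx : x ∈ s) =>
      exists_nhds_lintegral_normDet_comparable hf hf'c hinj hc hx
    obtain ⟨t, hts, htc, hcov⟩ := TopologicalSpace.countable_cover_nhdsWithin
      (f := V) (s := s) fun x hx => mem_nhdsWithin_of_mem_nhds ((hVo x hx).mem_nhds (hxV x hx))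
    rcases s.eq_empty_or_nonempty with rfl | hne
    · simp
    have htne : t.Nonempty := by
      obtain ⟨x, hx⟩ := hne
      obtain ⟨i, hi, -⟩ := mem_iUnion₂.1 (hcov hx)
      exact ⟨i, hi⟩
    obtain ⟨e, he⟩ := htc.exists_eq_range htne
    set S : ℕ → Set U := disjointed fun n => V (e n) ∩ s with hS
    have het : ∀ n, e n ∈ t := fun n => he ▸ mem_range_self n
    have hSm : ∀ n, MeasurableSet (S n) := fun n =>
      MeasurableSet.disjointed (fun n => (hVo _ (hts (het n))).measurableSet.inter hs) n
    have hSU : ⋃ n, S n = s := by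
      rw [hS, iUnion_disjointed, ← iUnion_inter, inter_eq_right]
      intro x hx
      obtain ⟨i, hi, hxi⟩ := mem_iUnion₂.1 (hcov hx)
      rw [he] at hi
      obtain ⟨n, rfl⟩ := hi
      exact mem_iUnion.2 ⟨n, hxi⟩
    have hSsub : ∀ n, S n ⊆ V (e n) ∩ s := fun n => disjointed_subset _ n
    have hSs : ∀ n, S n ⊆ s := fun n => (hSsub n).trans inter_subset_right
    have hdis : Pairwise (Function.onFun Disjoint S) := disjoint_disjointed _
    have hint : ∫⁻ y in s, ENNReal.ofReal (f' y).toLinearMap.normDet =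
        ∑' n, ∫⁻ y in S n, ENNReal.ofReal (f' y).toLinearMap.normDet := by
      rw [← lintegral_iUnion hSm hdis, hSU]
    have himg : μHE[finrank ℝ U] (f '' s) = ∑' n, μHE[finrank ℝ U] (f '' S n) := by
      rw [← hSU, image_iUnion, measure_iUnion]
      · intro i j hij
        rw [Function.onFun, Set.disjoint_iff_forall_ne]
        rintro _ ⟨x, hx, rfl⟩ _ ⟨y, hy, rfl⟩ hxy
        have := hfs (hSs i hx) (hSs j hy) hxy
        exact (Set.disjoint_left.1 (hdis hij)) hx (this ▸ hy)
      · exact fun n => (hSm n).image_of_continuousOn_injOn (hcont.mono (hSs n))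
          (hfs.mono (hSs n))
    rw [hint, himg, ← ENNReal.tsum_mul_left, ← ENNReal.tsum_mul_left]
    exact ⟨ENNReal.tsum_le_tsum fun n => (hV _ (hts (het n)) _ (hSsub n) (hSm n)).1,
      ENNReal.tsum_le_tsum fun n => (hV _ (hts (het n)) _ (hSsub n) (hSm n)).2⟩
  have lim : ∀ a b : ℝ≥0∞, (∀ c : ℝ≥0, 1 < c → a ≤ (c : ℝ≥0∞) ^ (finrank ℝ U + 1) * b) →
      a ≤ b := by
    intro a b h
    have ht : Tendsto (fun c : ℝ≥0 => ((c ^ (finrank ℝ U + 1) : ℝ≥0) : ℝ≥0∞) * b) (𝓝[>] 1)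
        (𝓝 (((1 ^ (finrank ℝ U + 1) : ℝ≥0) : ℝ≥0∞) * b)) := by
      refine ENNReal.Tendsto.mul_const ?_ (Or.inl (by simp))
      refine ENNReal.tendsto_coe.2 (Tendsto.mono_left ?_ nhdsWithin_le_nhds)
      exact (continuous_pow _).tendsto 1
    simp only [one_pow, ENNReal.coe_one, one_mul] at ht
    refine ge_of_tendsto ht ?_
    filter_upwards [self_mem_nhdsWithin] with c hc
    simpa using h c hc
  exact le_antisymm (lim _ _ fun c hc => (approx c hc).2) (lim _ _ fun c hc => (approx c hc).1)

/-- The area formula for an injective map with injective strict derivatives. -/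
theorem lintegral_image_euclideanHausdorffMeasure {f : U → F} {f' : U → U →L[ℝ] F} {s : Set U}
    (hs : MeasurableSet s)
    (hf : ∀ x ∈ s, HasStrictFDerivAt f (f' x) x) (hf'c : ContinuousOn f' s)
    (hinj : ∀ x ∈ s, Function.Injective (f' x)) (hfs : InjOn f s) (g : F → ℝ≥0∞) :
    ∫⁻ z in f '' s, g z ∂μHE[finrank ℝ U] =
      ∫⁻ y in s, ENNReal.ofReal (f' y).toLinearMap.normDet * g (f y) := by
  have hcont : ContinuousOn f s := fun x hx =>
    (hf x hx).hasFDerivAt.continuousAt.continuousWithinAt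
  have hemb : MeasurableEmbedding (s.domRestrict f) := hcont.measurableEmbedding hs hfs
  have hJm : AEMeasurable (fun y => ENNReal.ofReal (f' y).toLinearMap.normDet)
      (volume.restrict s) :=
    ((continuous_normDet.comp_continuousOn hf'c).aemeasurable hs).ennreal_ofReal
  set ν : Measure U :=
    volume.withDensity fun y => ENNReal.ofReal (f' y).toLinearMap.normDet with hν
  -- Hausdorff measure on the image is the push-forward of a weighted Lebesgue measure by a
  -- measurable embedding; for this reason `g` need not be measurable.
  have hmap : Measure.map (s.domRestrict f) (Measure.comap (↑) ν) =
      μHE[finrank ℝ U].restrict (f '' s) := by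
    ext t ht
    have hm : MeasurableSet ((↑) '' (s.domRestrict f ⁻¹' t) : Set U) :=
      (MeasurableEmbedding.subtype_coe hs).measurableSet_image.2 (hemb.measurable ht)
    rw [hemb.map_apply, (MeasurableEmbedding.subtype_coe hs).comap_apply, hν,
      withDensity_apply _ hm, Measure.restrict_apply ht]
    have hsub : ((↑) '' (s.domRestrict f ⁻¹' t) : Set U) = s ∩ f ⁻¹' t := by
      ext x; simp [and_comm]
    have hsub' : ((↑) '' (s.domRestrict f ⁻¹' t) : Set U) ⊆ s := by rw [hsub]; exact inter_subset_left
    rw [lintegral_normDet_eq_image hm (fun x hx => hf x (hsub' hx)) (hf'c.mono hsub')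
      (fun x hx => hinj x (hsub' hx)) (hfs.mono hsub'), hsub, image_inter_preimage, inter_comm]
  rw [← hmap, hemb.lintegral_map]
  simp only [Set.domRestrict_apply, ← Function.comp_apply (f := g)]
  rw [← (MeasurableEmbedding.subtype_coe hs).lintegral_map, map_comap_subtype_coe hs,
    setLIntegral_withDensity_eq_setLIntegral_mul_non_measurable₀ _ _ _ hs]
  · simp only [Pi.mul_apply]
  · simp only [eventually_true, ENNReal.ofReal_lt_top]
  · exact hJm

end AreaFormula

/-! ### Determinants of a parametrization and of its equations -/

section FiberLinearAlgebra

open Matrix Set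
open scoped ENNReal

/-- Here `A` parametrizes a subspace of the kernel of `J`, and `P` reads off the parameters. Let Q
be `P` stacked on `J`, and B = [A | Jᵀ]. Then QB is block triangular with determinant det(JJᵀ),
while BᵀB is block diagonal; comparing determinants gives the identity. -/
theorem det_mul_transpose_eq_sq_mul {u t f : Type*} [Fintype u] [Fintype t] [Fintype f]
    [DecidableEq u] [DecidableEq t] [DecidableEq f] (e : f ≃ u ⊕ t) {A : Matrix f u ℝ}
    {P : Matrix u f ℝ} {J : Matrix t f ℝ} (hPA : P * A = 1) (hJA : J * A = 0)
    (hJ : (J * Jᵀ).det ≠ 0) :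
    (J * Jᵀ).det = ((fromRows P J).submatrix e id).det ^ 2 * (Aᵀ * A).det := by
  set Q : Matrix f f ℝ := (fromRows P J).submatrix e id with hQ
  set B : Matrix f f ℝ := (fromCols A Jᵀ).submatrix id e with hB
  have h1 : Q * B = (fromBlocks 1 (P * Jᵀ) 0 (J * Jᵀ)).submatrix e e := by
    rw [hQ, hB, ← submatrix_mul _ _ e id e Function.bijective_id,
      fromRows_mul_fromCols, hPA, hJA]
  have h2 : Bᵀ * B = (fromBlocks (Aᵀ * A) 0 0 (J * Jᵀ)).submatrix e e := by
    have hT : Bᵀ = (fromRows Aᵀ J).submatrix e id := by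
      rw [hB, transpose_submatrix, transpose_fromCols, transpose_transpose]
    have hAJ : Aᵀ * Jᵀ = 0 := by rw [← transpose_mul, hJA, transpose_zero]
    rw [hT, hB, ← submatrix_mul _ _ e id e Function.bijective_id,
      fromRows_mul_fromCols, hJA, hAJ]
  have d1 := congrArg det h1
  have d2 := congrArg det h2
  rw [det_mul, det_submatrix_equiv_self, det_fromBlocks_zero₂₁, det_one, one_mul] at d1
  rw [det_mul, det_transpose, det_submatrix_equiv_self, det_fromBlocks_zero₂₁] at d2
  have : (J * Jᵀ).det * (J * Jᵀ).det = (J * Jᵀ).det * (Q.det ^ 2 * (Aᵀ * A).det) := by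
    calc _ = (Q.det * B.det) * (Q.det * B.det) := by rw [d1]
      _ = Q.det ^ 2 * (B.det * B.det) := by ring
      _ = _ := by rw [d2]; ring
  exact mul_left_cancel₀ hJ this

theorem lintegral_image_toLp_euclideanHausdorffMeasure {u f : Type*} [Fintype u] [Fintype f]
    [DecidableEq u] {ψ : (u → ℝ) → f → ℝ} {ψ' : (u → ℝ) → (u → ℝ) →L[ℝ] f → ℝ}
    {s : Set (u → ℝ)} (hs : MeasurableSet s) (hψ : ∀ x ∈ s, HasStrictFDerivAt ψ (ψ' x) x)
    (hψ' : ContinuousOn ψ' s) (hinj : ∀ x ∈ s, Function.Injective (ψ' x)) (hψs : InjOn ψ s)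
    (g : EuclideanSpace ℝ f → ℝ≥0∞) :
    ∫⁻ z in (WithLp.toLp 2) '' (ψ '' s), g z ∂μHE[Fintype.card u] =
      ∫⁻ y in s, ENNReal.ofReal
        √((LinearMap.toMatrix' (ψ' y : (u → ℝ) →ₗ[ℝ] f → ℝ))ᵀ *
          LinearMap.toMatrix' (ψ' y : (u → ℝ) →ₗ[ℝ] f → ℝ)).det * g (WithLp.toLp 2 (ψ y)) := by
  set eu := (PiLp.continuousLinearEquiv 2 ℝ fun _ : u => ℝ)
  set ef := (PiLp.continuousLinearEquiv 2 ℝ fun _ : f => ℝ)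
  set Ψ : EuclideanSpace ℝ u → EuclideanSpace ℝ f := fun x => ef.symm (ψ (eu x)) with hΨ
  set Ψ' : EuclideanSpace ℝ u → EuclideanSpace ℝ u →L[ℝ] EuclideanSpace ℝ f := fun x =>
    (ef.symm : (f → ℝ) →L[ℝ] EuclideanSpace ℝ f) ∘L ψ' (eu x) ∘L
      (eu : EuclideanSpace ℝ u →L[ℝ] u → ℝ) with hΨ'
  have hdim : Module.finrank ℝ (EuclideanSpace ℝ u) = Fintype.card u := finrank_euclideanSpace
  have key := lintegral_image_euclideanHausdorffMeasure (f := Ψ) (f' := Ψ') (s := eu ⁻¹' s)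
    (hs.preimage eu.continuous.measurable)
    (fun x hx => (ef.symm.hasStrictFDerivAt).comp x ((hψ _ hx).comp x eu.hasStrictFDerivAt))
    (by
      refine ContinuousOn.clm_comp continuousOn_const (ContinuousOn.clm_comp ?_ continuousOn_const)
      exact hψ'.comp eu.continuous.continuousOn fun x hx => hx)
    (fun x hx => ef.symm.injective.comp ((hinj _ hx).comp eu.injective))
    (fun x hx y hy hxy => eu.injective (hψs hx hy (ef.symm.injective hxy))) g
  rw [hdim] at key
  have himg : Ψ '' (eu ⁻¹' s) = (WithLp.toLp 2) '' (ψ '' s) := by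
    ext z
    constructor
    · rintro ⟨x, hx, rfl⟩
      exact ⟨_, ⟨_, hx, rfl⟩, rfl⟩
    · rintro ⟨_, ⟨x, hx, rfl⟩, rfl⟩
      exact ⟨eu.symm x, by simpa using hx, by simp [hΨ, ef]⟩
  rw [himg] at key
  rw [key]
  have hmp : MeasurePreserving (MeasurableEquiv.toLp 2 (u → ℝ)).symm :=
    (PiLp.volume_preserving_ofLp u)
  rw [← hmp.setLIntegral_comp_preimage_emb (MeasurableEquiv.measurableEmbedding _)]
  refine lintegral_congr fun x => ?_
  change _ * g (WithLp.toLp 2 (ψ (eu x))) = _ * g (WithLp.toLp 2 (ψ (eu x)))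
  congr 2
  rw [← Real.sqrt_sq (LinearMap.normDet_nonneg _)]
  congr 1
  have := (Ψ' x).toLinearMap.normDet_sq_eq_det_gram (EuclideanSpace.basisFun u ℝ)
  rw [RCLike.ofReal_real_eq_id, id] at this
  rw [this]
  congr 1
  ext i j
  simp only [Matrix.gram_apply, Matrix.mul_apply, Matrix.transpose_apply]
  rw [PiLp.inner_apply]
  refine Finset.sum_congr rfl fun k _ => ?_
  simp [hΨ', LinearMap.toMatrix'_apply, ef, eu, mul_comm]
  rfl

end FiberLinearAlgebra

/-! ### Gram determinants as a rank test -/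

section GramDeterminant

open Matrix

theorem det_mul_transpose_ne_zero_iff {m n : Type*} [Fintype m] [DecidableEq m] [Fintype n]
    (M : Matrix m n ℝ) : (M * Mᵀ).det ≠ 0 ↔ ∀ v, v ᵥ* M = 0 → v = 0 := by
  rw [Ne, ← exists_vecMul_eq_zero_iff]
  push Not
  have h : ∀ v, v ᵥ* (M * Mᵀ) = 0 ↔ v ᵥ* M = 0 := fun v => by
    simpa using vecMul_self_mul_conjTranspose_eq_zero M v
  simp only [Ne, h]
  exact ⟨fun H v hv => by_contra fun h0 => H v h0 hv, fun H v h0 hv => h0 (H v hv)⟩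

theorem det_mul_transpose_nonneg {m n : Type*} [Fintype m] [DecidableEq m] [Fintype n]
    (M : Matrix m n ℝ) : 0 ≤ (M * Mᵀ).det := by
  simpa using (posSemidef_self_mul_conjTranspose M).det_nonneg

end GramDeterminant

/-! ### Charts that straighten a submersion -/

section Chart

open Matrix Set
open scoped ENNReal

variable {σ : Type*} {N d : ℕ}

/-- The coordinates `(t, v)` glued along a numbering of the index set. -/
noncomputable def glue (e : Fin N ⊕ Fin d ≃ σ) :
    ((Fin N → ℝ) × (Fin d → ℝ)) ≃L[ℝ] (σ → ℝ) :=
  ((LinearEquiv.sumArrowLequivProdArrow (Fin N) (Fin d) ℝ ℝ).symm.trans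
    (LinearEquiv.funCongrLeft ℝ ℝ e.symm)).toContinuousLinearEquiv

theorem glue_apply (e : Fin N ⊕ Fin d ≃ σ) (p : (Fin N → ℝ) × (Fin d → ℝ)) (i : σ) :
    glue e p i = Sum.elim p.1 p.2 (e.symm i) := by
  simp only [glue, LinearEquiv.coe_toContinuousLinearEquiv', LinearEquiv.trans_apply,
    LinearEquiv.funCongrLeft_apply, LinearMap.funLeft_apply]
  rcases e.symm i with j | j <;> rfl

variable [Fintype σ]

theorem measurePreserving_glue (e : Fin N ⊕ Fin d ≃ σ) : MeasurePreserving (glue e) := by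
  have h1 := volume_measurePreserving_sumPiEquivProdPi_symm (fun _ : Fin N ⊕ Fin d => ℝ)
  have h2 := volume_measurePreserving_piCongrLeft (fun _ : σ => ℝ) e
  have h3 := h2.comp h1
  convert! h3 using 1
  ext p i
  rw [glue_apply]
  obtain ⟨j, rfl⟩ := e.surjective i
  simp only [Equiv.symm_apply_apply, Function.comp_apply, MeasurableEquiv.coe_piCongrLeft,
    Equiv.piCongrLeft_apply_apply]
  rcases j with j | j <;> rfl

/-- The derivative of `x ↦ glue e (φ x, L x)`. -/
noncomputable def glueDeriv (e : Fin N ⊕ Fin d ≃ σ) (b : (σ → ℝ) →L[ℝ] (Fin N → ℝ))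
    (L : (σ → ℝ) →L[ℝ] (Fin d → ℝ)) : (σ → ℝ) →L[ℝ] (σ → ℝ) :=
  (glue e : ((Fin N → ℝ) × (Fin d → ℝ)) →L[ℝ] (σ → ℝ)) ∘L b.prod L

/-- Take for `L` a linear retraction onto the kernel of `b`, identified with ℝ^d; then `b` and `L`
have no common kernel. -/
theorem exists_complement_glueDeriv_det_ne_zero (e : Fin N ⊕ Fin d ≃ σ)
    {b : (σ → ℝ) →L[ℝ] (Fin N → ℝ)} (hb : Function.Surjective b) :
    ∃ L : (σ → ℝ) →L[ℝ] (Fin d → ℝ), (glueDeriv e b L).det ≠ 0 := by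
  obtain ⟨p, hp⟩ := (LinearMap.ker (b : (σ → ℝ) →ₗ[ℝ] (Fin N → ℝ))).subtype.exists_leftInverse_of_injective
    (Submodule.ker_subtype _)
  have hrank := LinearMap.finrank_range_add_finrank_ker (b : (σ → ℝ) →ₗ[ℝ] (Fin N → ℝ))
  rw [LinearMap.range_eq_top.2 hb, finrank_top] at hrank
  simp only [Module.finrank_fintype_fun_eq_card, Fintype.card_fin] at hrank
  have hcard : Fintype.card σ = N + d := by
    rw [← Fintype.card_congr e]; simp
  have hk : Module.finrank ℝ (LinearMap.ker (b : (σ → ℝ) →ₗ[ℝ] (Fin N → ℝ))) =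
      Module.finrank ℝ (Fin d → ℝ) := by
    rw [Module.finrank_fintype_fun_eq_card, Fintype.card_fin]; omega
  set ι := LinearEquiv.ofFinrankEq _ _ hk
  refine ⟨LinearMap.toContinuousLinearMap (ι.toLinearMap ∘ₗ p), ?_⟩
  rw [ContinuousLinearMap.det, Ne, LinearMap.det_eq_zero_iff_ker_ne_bot, not_not,
    LinearMap.ker_eq_bot']
  intro x hx
  have hx' : (b x, ι (p x)) = 0 := (glue e).map_eq_zero_iff.1 hx
  rw [Prod.mk_eq_zero, LinearEquiv.map_eq_zero_iff] at hx'
  have := LinearMap.congr_fun hp ⟨x, hx'.1⟩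
  simp only [LinearMap.comp_apply, Submodule.subtype_apply, LinearMap.id_apply, hx'.2] at this
  exact (congrArg Subtype.val this).symm

theorem exists_chart (e : Fin N ⊕ Fin d ≃ σ) {φ : (σ → ℝ) → (Fin N → ℝ)} (hφ : ContDiff ℝ 1 φ)
    {y : σ → ℝ} (hy : Function.Surjective (fderiv ℝ φ y)) :
    ∃ (L : (σ → ℝ) →L[ℝ] (Fin d → ℝ)) (H : OpenPartialHomeomorph (σ → ℝ) (σ → ℝ)),
      (∀ x, H x = glue e (φ x, L x)) ∧ y ∈ H.source ∧
        ∀ x ∈ H.source, (glueDeriv e (fderiv ℝ φ x) L).det ≠ 0 := by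
  obtain ⟨L, hL⟩ := exists_complement_glueDeriv_det_ne_zero e hy
  have hΘ : ContDiff ℝ 1 fun x => glue e (φ x, L x) :=
    (glue e).contDiff.comp (hφ.prodMk L.contDiff)
  have hd : HasFDerivAt (fun x => glue e (φ x, L x)) (glueDeriv e (fderiv ℝ φ y) L) y :=
    (glue e).hasFDerivAt.comp y
      (((hφ.differentiable (by norm_num)) y).hasFDerivAt.prodMk L.hasFDerivAt)
  set E := (glueDeriv e (fderiv ℝ φ y) L).toContinuousLinearEquivOfDetNeZero hL
  have hd' : HasFDerivAt (fun x => glue e (φ x, L x)) (E : (σ → ℝ) →L[ℝ] (σ → ℝ)) y := by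
    rwa [ContinuousLinearMap.coe_toContinuousLinearEquivOfDetNeZero]
  set H := hΘ.contDiffAt.toOpenPartialHomeomorph _ hd' (by norm_num)
  -- The source is cut down to this open set so that the derivative is invertible throughout the
  -- chart, not only at `y`.
  have hopen : IsOpen {x | (glueDeriv e (fderiv ℝ φ x) L).det ≠ 0} := by
    refine isOpen_ne_fun (ContinuousLinearMap.continuous_det.comp ?_) continuous_const
    refine continuous_const.clm_comp ?_
    exact (ContinuousLinearMap.prodₗᵢ ℝ (E := σ → ℝ) (F := Fin N → ℝ) (G := Fin d → ℝ)
      (𝕜 := ℝ)).continuous.comp ((hφ.continuous_fderiv (by norm_num)).prodMk continuous_const)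
  refine ⟨L, H.restrOpen _ hopen, fun x => rfl, ⟨?_, hL⟩, fun x hx => hx.2⟩
  exact hΘ.contDiffAt.mem_toOpenPartialHomeomorph_source hd' (by norm_num)

/-- This cancellation turns the weight 1/√G₀ into a density. `A` is the derivative of the
parametrization (x, v) ↦ (x, y) of φ(x) = φ(y), and [−a | b] is, up to sign, the derivative of the
equations. In `det_mul_transpose_eq_sq_mul` the stacked matrix is block lower triangular with
diagonal blocks 1 and the chart derivative, so only the determinant of the latter survives. -/
theorem sqrt_det_mul_one_div_sqrt_det [DecidableEq σ] (e : Fin N ⊕ Fin d ≃ σ)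
    (a b : (σ → ℝ) →L[ℝ] (Fin N → ℝ)) (L : (σ → ℝ) →L[ℝ] (Fin d → ℝ))
    (hdet : (glueDeriv e b L).det ≠ 0)
    (A : (σ ⊕ Fin d → ℝ) →L[ℝ] (σ ⊕ σ → ℝ))
    (hA₁ : ∀ u i, A u (Sum.inl i) = u (Sum.inl i))
    (hA₂ : ∀ u, L (fun i => A u (Sum.inr i)) = fun j => u (Sum.inr j))
    (hA₃ : ∀ u, b (fun i => A u (Sum.inr i)) = a (fun i => A u (Sum.inl i))) :
    √((LinearMap.toMatrix' (A : (σ ⊕ Fin d → ℝ) →ₗ[ℝ] (σ ⊕ σ → ℝ)))ᵀ *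
        LinearMap.toMatrix' (A : (σ ⊕ Fin d → ℝ) →ₗ[ℝ] (σ ⊕ σ → ℝ))).det *
      (1 / √(LinearMap.toMatrix' (a : (σ → ℝ) →ₗ[ℝ] (Fin N → ℝ)) *
          (LinearMap.toMatrix' (a : (σ → ℝ) →ₗ[ℝ] (Fin N → ℝ)))ᵀ +
        LinearMap.toMatrix' (b : (σ → ℝ) →ₗ[ℝ] (Fin N → ℝ)) *
          (LinearMap.toMatrix' (b : (σ → ℝ) →ₗ[ℝ] (Fin N → ℝ)))ᵀ).det) =
      |(glueDeriv e b L).det|⁻¹ := by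
  set Am := LinearMap.toMatrix' (A : (σ ⊕ Fin d → ℝ) →ₗ[ℝ] (σ ⊕ σ → ℝ)) with hAm
  set Ja := LinearMap.toMatrix' (a : (σ → ℝ) →ₗ[ℝ] (Fin N → ℝ)) with hJa
  set Jb := LinearMap.toMatrix' (b : (σ → ℝ) →ₗ[ℝ] (Fin N → ℝ)) with hJb
  set Lm := LinearMap.toMatrix' (L : (σ → ℝ) →ₗ[ℝ] (Fin d → ℝ)) with hLm
  set P : Matrix (σ ⊕ Fin d) (σ ⊕ σ) ℝ := fromBlocks 1 0 0 Lm with hP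
  set J : Matrix (Fin N) (σ ⊕ σ) ℝ := fromCols (-Ja) Jb with hJ
  have hmv : ∀ u, Am *ᵥ u = A u := fun u => LinearMap.toMatrix'_mulVec _ _
  have hPA : P * Am = 1 := by
    refine Matrix.ext_of_mulVec_single fun i => ?_
    rw [← mulVec_mulVec, hmv, one_mulVec, hP, fromBlocks_mulVec]
    have h2 : Lm *ᵥ (A (Pi.single i 1) ∘ Sum.inr) = fun j => (Pi.single i 1 : σ ⊕ Fin d → ℝ) (Sum.inr j) :=
      (LinearMap.toMatrix'_mulVec _ _).trans (hA₂ _)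
    rw [h2]
    ext (j | j)
    · simp [hA₁]
    · simp
  have hJA : J * Am = 0 := by
    refine Matrix.ext_of_mulVec_single fun i => ?_
    rw [← mulVec_mulVec, hmv, zero_mulVec, hJ, fromCols_mulVec, neg_mulVec]
    have h1 : Ja *ᵥ (A (Pi.single i 1) ∘ Sum.inl) = a (fun k => A (Pi.single i 1) (Sum.inl k)) :=
      LinearMap.toMatrix'_mulVec _ _
    have h2 : Jb *ᵥ (A (Pi.single i 1) ∘ Sum.inr) = b (fun k => A (Pi.single i 1) (Sum.inr k)) :=
      LinearMap.toMatrix'_mulVec _ _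
    rw [h1, h2, hA₃, neg_add_cancel]
  have hJJ : J * Jᵀ = Ja * Jaᵀ + Jb * Jbᵀ := by
    rw [hJ, transpose_fromCols, fromCols_mul_fromRows, transpose_neg, Matrix.neg_mul, Matrix.mul_neg, neg_neg]
  have hmat : LinearMap.toMatrix' (glueDeriv e b L : (σ → ℝ) →ₗ[ℝ] (σ → ℝ)) =
      (fromRows Jb Lm).submatrix e.symm id := by
    ext i j
    rw [LinearMap.toMatrix'_apply, submatrix_apply]
    change glue e (b _, L _) i = _
    rw [glue_apply]
    rcases e.symm i with k | k
    · simp [hJb, LinearMap.toMatrix'_apply]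
    · simp [hLm, LinearMap.toMatrix'_apply]
  have hbs : Function.Surjective b := by
    intro t
    have hu : IsUnit (LinearMap.det (glueDeriv e b L : (σ → ℝ) →ₗ[ℝ] (σ → ℝ))) :=
      isUnit_iff_ne_zero.2 hdet
    obtain ⟨x, hx⟩ := ((Module.End.isUnit_iff _).1 ((LinearMap.isUnit_iff_isUnit_det _).2 hu)).2
      (glue e (t, 0))
    exact ⟨x, congrArg Prod.fst ((glue e).injective hx)⟩
  have hJdet : (J * Jᵀ).det ≠ 0 := by
    rw [det_mul_transpose_ne_zero_iff]
    intro v hv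
    have hv' : v ᵥ* Jb = 0 := by
      rw [hJ, vecMul_fromCols] at hv
      ext i
      exact congrFun hv (Sum.inr i)
    obtain ⟨x, hx⟩ := hbs v
    have hx' : Jb *ᵥ x = v := (LinearMap.toMatrix'_mulVec _ _).trans hx
    have := congrArg (fun w => w ⬝ᵥ x) hv'
    simp only [← dotProduct_mulVec, hx', zero_dotProduct] at this
    exact dotProduct_self_eq_zero.1 this
  -- The second copy of σ is split by `e` into equations and free coordinates, and the free ones are
  -- moved next to the first copy, to match the row order of `P` over `J`.
  set e' : σ ⊕ σ ≃ (σ ⊕ Fin d) ⊕ Fin N :=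
    (Equiv.sumCongr (Equiv.refl σ) (e.symm.trans (Equiv.sumComm _ _))).trans
      (Equiv.sumAssoc σ (Fin d) (Fin N)).symm with he'
  have key := det_mul_transpose_eq_sq_mul e' hPA hJA hJdet
  have hQ : (fromRows P J).submatrix e' id = fromBlocks 1 0
      ((fromRows (-Ja) 0).submatrix e.symm id) ((fromRows Jb Lm).submatrix e.symm id) := by
    ext (i | i) (j | j)
    · simp [he', hP]
    · simp [he', hP]
    · rw [submatrix_apply, fromBlocks_apply₂₁, submatrix_apply]
      rcases h : e.symm i with k | k <;> simp [he', h, hP, hJ]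
    · rw [submatrix_apply, fromBlocks_apply₂₂, submatrix_apply]
      rcases h : e.symm i with k | k <;> simp [he', h, hP, hJ]
  have hD : ((fromRows P J).submatrix e' id).det = (glueDeriv e b L).det := by
    rw [hQ, det_fromBlocks_zero₁₂, det_one, one_mul, ← hmat, LinearMap.det_toMatrix']
  rw [hD] at key
  rw [← hJJ, key, Real.sqrt_mul (sq_nonneg _), Real.sqrt_sq_eq_abs]
  have hAA : (Amᵀ * Am).det ≠ 0 := by
    rintro h0
    rw [h0, mul_zero] at key
    exact hJdet key
  have hAA' : 0 < (Amᵀ * Am).det := by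
    refine lt_of_le_of_ne ?_ (Ne.symm hAA)
    simpa using det_mul_transpose_nonneg Amᵀ
  have := Real.sqrt_pos.2 hAA'
  field_simp

end Chart

/-! ### Density of the image measure in one chart -/

section FiberProduct

open Matrix Set
open scoped ENNReal

variable {σ : Type*} [Fintype σ] {N d : ℕ}

/-- The density of the image of Lebesgue measure on a piece `B` of a chart. -/
noncomputable def chartDensity (e : Fin N ⊕ Fin d ≃ σ) (φ : (σ → ℝ) → (Fin N → ℝ))
    (L : (σ → ℝ) →L[ℝ] (Fin d → ℝ)) (H : OpenPartialHomeomorph (σ → ℝ) (σ → ℝ))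
    (B : Set (σ → ℝ)) : (σ → ℝ) → ℝ≥0∞ :=
  (H '' B).indicator fun w =>
    ENNReal.ofReal |(glueDeriv e (fderiv ℝ φ (H.symm w)) L).det|⁻¹

variable {e : Fin N ⊕ Fin d ≃ σ} {φ : (σ → ℝ) → (Fin N → ℝ)}
  {L : (σ → ℝ) →L[ℝ] (Fin d → ℝ)} {H : OpenPartialHomeomorph (σ → ℝ) (σ → ℝ)}

theorem hasFDerivAt_chart (hφ : ContDiff ℝ 1 φ) (x : σ → ℝ) :
    HasFDerivAt (fun x => glue e (φ x, L x)) (glueDeriv e (fderiv ℝ φ x) L) x :=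
  (glue e).hasFDerivAt.comp x
    (((hφ.differentiable (by norm_num)) x).hasFDerivAt.prodMk L.hasFDerivAt)

theorem continuous_glueDeriv_fderiv (hφ : ContDiff ℝ 1 φ) :
    Continuous fun x => (glueDeriv e (fderiv ℝ φ x) L).det := by
  refine ContinuousLinearMap.continuous_det.comp (continuous_const.clm_comp ?_)
  exact (ContinuousLinearMap.prodₗᵢ ℝ (E := σ → ℝ) (F := Fin N → ℝ) (G := Fin d → ℝ)
    (𝕜 := ℝ)).continuous.comp ((hφ.continuous_fderiv (by norm_num)).prodMk continuous_const)

theorem contDiffOn_chart_symm (hφ : ContDiff ℝ 1 φ) (hH : ∀ x, H x = glue e (φ x, L x))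
    (hdet : ∀ x ∈ H.source, (glueDeriv e (fderiv ℝ φ x) L).det ≠ 0) :
    ContDiffOn ℝ 1 H.symm H.target := by
  have hH' : (H : (σ → ℝ) → (σ → ℝ)) = fun x => glue e (φ x, L x) := funext hH
  intro w hw
  have hs := H.map_target hw
  refine (H.contDiffAt_symm (f₀' := (glueDeriv e (fderiv ℝ φ (H.symm w))
    L).toContinuousLinearEquivOfDetNeZero (hdet _ hs)) hw ?_ ?_).contDiffWithinAt
  · rw [ContinuousLinearMap.coe_toContinuousLinearEquivOfDetNeZero, hH']
    exact hasFDerivAt_chart hφ _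
  · rw [hH']
    exact ((glue e).contDiff.comp (hφ.prodMk L.contDiff)).contDiffAt

theorem measurableSet_chart_image {B : Set (σ → ℝ)} (hB : MeasurableSet B) (hBs : B ⊆ H.source) :
    MeasurableSet (H '' B) :=
  hB.image_of_continuousOn_injOn (H.continuousOn.mono hBs) (H.injOn.mono hBs)

theorem measurable_chartDensity (hφ : ContDiff ℝ 1 φ)
    (hdet : ∀ x ∈ H.source, (glueDeriv e (fderiv ℝ φ x) L).det ≠ 0)
    {B : Set (σ → ℝ)} (hB : MeasurableSet B) (hBs : B ⊆ H.source) :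
    Measurable (chartDensity e φ L H B) := by
  classical
  have hsub : H '' B ⊆ H.target := by
    rintro _ ⟨x, hx, rfl⟩
    exact H.map_source (hBs hx)
  have hc : ContinuousOn (fun w => |(glueDeriv e (fderiv ℝ φ (H.symm w)) L).det|⁻¹) H.target := by
    refine ContinuousOn.inv₀ ?_ fun w hw => abs_ne_zero.2 (hdet _ (H.map_target hw))
    exact ((continuous_glueDeriv_fderiv hφ).comp_continuousOn H.symm.continuousOn).abs
  have hc' : ContinuousOn (fun w => ENNReal.ofReal
      |(glueDeriv e (fderiv ℝ φ (H.symm w)) L).det|⁻¹) H.target :=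
    ENNReal.continuous_ofReal.comp_continuousOn hc
  have hm := (hc'.measurable_piecewise (g := fun _ => 0) continuousOn_const
    H.open_target.measurableSet).indicator (measurableSet_chart_image hB hBs)
  rw [chartDensity]
  convert! hm using 1
  exact Set.indicator_congr fun w hw => by rw [piecewise_eq_of_mem _ _ _ (hsub hw)]

/-- The density of the image under `φ` of Lebesgue measure on a piece of a chart. -/
noncomputable def fiberDensity (e : Fin N ⊕ Fin d ≃ σ) (φ : (σ → ℝ) → (Fin N → ℝ))
    (L : (σ → ℝ) →L[ℝ] (Fin d → ℝ)) (H : OpenPartialHomeomorph (σ → ℝ) (σ → ℝ))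
    (B : Set (σ → ℝ)) (t : Fin N → ℝ) : ℝ≥0∞ :=
  ∫⁻ v : Fin d → ℝ, chartDensity e φ L H B (glue e (t, v))

theorem measurable_fiberDensity (hφ : ContDiff ℝ 1 φ)
    (hdet : ∀ x ∈ H.source, (glueDeriv e (fderiv ℝ φ x) L).det ≠ 0)
    {B : Set (σ → ℝ)} (hB : MeasurableSet B) (hBs : B ⊆ H.source) :
    Measurable (fiberDensity e φ L H B) :=
  Measurable.lintegral_prod_right'
    (f := fun p => chartDensity e φ L H B (glue e p))
    ((measurable_chartDensity hφ hdet hB hBs).comp (glue e).continuous.measurable)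

/-- Fubini reassembles the fiber integrals into an integral over the chart image. Changing variables
back by `H` brings in the Jacobian, which cancels the density and leaves the volume of φ⁻¹(T) ∩ B.
-/
theorem map_restrict_eq_withDensity_fiberDensity (hφ : ContDiff ℝ 1 φ)
    (hH : ∀ x, H x = glue e (φ x, L x))
    (hdet : ∀ x ∈ H.source, (glueDeriv e (fderiv ℝ φ x) L).det ≠ 0)
    {B : Set (σ → ℝ)} (hB : MeasurableSet B) (hBs : B ⊆ H.source) :
    (volume.restrict B).map φ = volume.withDensity (fiberDensity e φ L H B) := by
  have hH' : (H : (σ → ℝ) → (σ → ℝ)) = fun x => glue e (φ x, L x) := funext hH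
  have hφm : Measurable φ := hφ.continuous.measurable
  have hcm := measurable_chartDensity hφ hdet hB hBs
  ext T hT
  rw [Measure.map_apply hφm hT, Measure.restrict_apply (hφm hT), withDensity_apply _ hT]
  have hBT : MeasurableSet (φ ⁻¹' T ∩ B) := (hφm hT).inter hB
  have hBTs : φ ⁻¹' T ∩ B ⊆ H.source := inter_subset_right.trans hBs
  have hmeas : Measurable fun p : (Fin N → ℝ) × (Fin d → ℝ) => chartDensity e φ L H B (glue e p) :=
    hcm.comp (glue e).continuous.measurable
  have h1 : ∫⁻ t in T, fiberDensity e φ L H B t =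
      ∫⁻ p in T ×ˢ (univ : Set (Fin d → ℝ)), chartDensity e φ L H B (glue e p) := by
    rw [Measure.volume_eq_prod, ← Measure.prod_restrict, lintegral_prod _ hmeas.aemeasurable]
    simp only [Measure.restrict_univ]
    rfl
  have himg : H '' B ∩ glue e '' (T ×ˢ (univ : Set (Fin d → ℝ))) = H '' (φ ⁻¹' T ∩ B) := by
    ext w
    constructor
    · rintro ⟨⟨x, hx, hxp⟩, ⟨p, ⟨hp, -⟩, rfl⟩⟩
      refine ⟨x, ⟨?_, hx⟩, hxp⟩
      rw [hH] at hxp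
      have := (glue e).injective hxp
      rw [← this] at hp
      exact hp
    · rintro ⟨x, ⟨hxT, hxB⟩, rfl⟩
      exact ⟨⟨x, hxB, rfl⟩, ⟨(φ x, L x), ⟨hxT, mem_univ _⟩, (hH x).symm⟩⟩
  have hTm : MeasurableSet (glue e '' (T ×ˢ (univ : Set (Fin d → ℝ)))) :=
    (glue e).toHomeomorph.measurableEmbedding.measurableSet_image.2 (hT.prod MeasurableSet.univ)
  have h2 : ∫⁻ p in T ×ˢ (univ : Set (Fin d → ℝ)), chartDensity e φ L H B (glue e p) =
      ∫⁻ w in glue e '' (T ×ˢ (univ : Set (Fin d → ℝ))), chartDensity e φ L H B w := by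
    rw [← (measurePreserving_glue e).setLIntegral_comp_preimage_emb
      (glue e).toHomeomorph.measurableEmbedding, preimage_image_eq _ (glue e).injective]
  rw [h1, h2, chartDensity, setLIntegral_indicator (measurableSet_chart_image hB hBs),
    himg, lintegral_image_eq_lintegral_abs_det_fderiv_mul volume hBT
      (f' := fun x => glueDeriv e (fderiv ℝ φ x) L)
      (fun x _ => by rw [hH']; exact (hasFDerivAt_chart hφ x).hasFDerivWithinAt)
      (H.injOn.mono hBTs)]
  rw [setLIntegral_congr_fun hBT (g := fun _ => 1), setLIntegral_one]
  intro x hx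
  have hx' := hBTs hx
  simp only [H.left_inv hx']
  rw [← ENNReal.ofReal_mul (abs_nonneg _), mul_inv_cancel₀ (abs_ne_zero.2 (hdet x hx')),
    ENNReal.ofReal_one]

end FiberProduct

/-! ### The surface φ(x) = φ(y) over one chart -/

section FiberSurface

open Matrix Set
open scoped ENNReal

variable {σ : Type*} {N d : ℕ}

/-- The fiber product of `A` and `B` over `φ`. -/
def fiberProduct (φ : (σ → ℝ) → (Fin N → ℝ)) (A B : Set (σ → ℝ)) : Set (σ ⊕ σ → ℝ) :=
  {z | z ∘ Sum.inl ∈ A ∧ z ∘ Sum.inr ∈ B ∧ φ (z ∘ Sum.inl) = φ (z ∘ Sum.inr)}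

/-- The parametrization of the fiber product by the first point and the free chart coordinates of
the second point. -/
noncomputable def fiberParam (e : Fin N ⊕ Fin d ≃ σ) (φ : (σ → ℝ) → (Fin N → ℝ))
    (H : OpenPartialHomeomorph (σ → ℝ) (σ → ℝ)) (u : σ ⊕ Fin d → ℝ) : σ ⊕ σ → ℝ :=
  Sum.elim (u ∘ Sum.inl) (H.symm (glue e (φ (u ∘ Sum.inl), u ∘ Sum.inr)))

variable {e : Fin N ⊕ Fin d ≃ σ} {φ : (σ → ℝ) → (Fin N → ℝ)}
  {L : (σ → ℝ) →L[ℝ] (Fin d → ℝ)} {H : OpenPartialHomeomorph (σ → ℝ) (σ → ℝ)}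

theorem fiberParam_spec (hH : ∀ x, H x = glue e (φ x, L x)) {u : σ ⊕ Fin d → ℝ}
    (hu : glue e (φ (u ∘ Sum.inl), u ∘ Sum.inr) ∈ H.target) :
    φ (fiberParam e φ H u ∘ Sum.inr) = φ (u ∘ Sum.inl) ∧
      L (fiberParam e φ H u ∘ Sum.inr) = u ∘ Sum.inr := by
  have h1 := H.right_inv hu
  rw [hH] at h1
  exact Prod.mk.inj ((glue e).injective h1)

variable [Fintype σ]

theorem contDiff_glue_param (hφ : ContDiff ℝ 1 φ) :
    ContDiff ℝ 1 fun u : σ ⊕ Fin d → ℝ => glue e (φ (u ∘ Sum.inl), u ∘ Sum.inr) := by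
  refine (glue e).contDiff.comp (ContDiff.prodMk (hφ.comp ?_) ?_)
  · exact contDiff_pi.2 fun i => contDiff_apply _ _ _
  · exact contDiff_pi.2 fun i => contDiff_apply _ _ _

theorem isOpen_fiberParam_domain (hφ : ContDiff ℝ 1 φ) :
    IsOpen {u : σ ⊕ Fin d → ℝ | glue e (φ (u ∘ Sum.inl), u ∘ Sum.inr) ∈ H.target} :=
  H.open_target.preimage (contDiff_glue_param hφ).continuous

theorem contDiffOn_fiberParam (hφ : ContDiff ℝ 1 φ) (hH : ∀ x, H x = glue e (φ x, L x))
    (hdet : ∀ x ∈ H.source, (glueDeriv e (fderiv ℝ φ x) L).det ≠ 0) :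
    ContDiffOn ℝ 1 (fiberParam e φ H)
      {u : σ ⊕ Fin d → ℝ | glue e (φ (u ∘ Sum.inl), u ∘ Sum.inr) ∈ H.target} := by
  rw [contDiffOn_pi]
  rintro (i | i)
  · exact (contDiff_apply ℝ ℝ (Sum.inl i)).contDiffOn
  · exact (contDiffOn_pi.1 ((contDiffOn_chart_symm hφ hH hdet).comp
      (contDiff_glue_param hφ).contDiffOn fun u hu => hu)) i

/-- These are the differentiated forms of the identities that define the parametrization, in the
shape demanded by `sqrt_det_mul_one_div_sqrt_det`. The identities hold near `u`, which suffices by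
uniqueness of the derivative. -/
theorem fderiv_fiberParam_spec (hφ : ContDiff ℝ 1 φ) (hH : ∀ x, H x = glue e (φ x, L x))
    (hdet : ∀ x ∈ H.source, (glueDeriv e (fderiv ℝ φ x) L).det ≠ 0) {u : σ ⊕ Fin d → ℝ}
    (hu : glue e (φ (u ∘ Sum.inl), u ∘ Sum.inr) ∈ H.target) :
    (∀ w i, fderiv ℝ (fiberParam e φ H) u w (Sum.inl i) = w (Sum.inl i)) ∧
    (∀ w, L (fun i => fderiv ℝ (fiberParam e φ H) u w (Sum.inr i)) = fun j => w (Sum.inr j)) ∧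
    (∀ w, fderiv ℝ φ (fiberParam e φ H u ∘ Sum.inr)
        (fun i => fderiv ℝ (fiberParam e φ H) u w (Sum.inr i)) =
      fderiv ℝ φ (u ∘ Sum.inl) (fun i => fderiv ℝ (fiberParam e φ H) u w (Sum.inl i))) := by
  have hO : {u : σ ⊕ Fin d → ℝ | glue e (φ (u ∘ Sum.inl), u ∘ Sum.inr) ∈ H.target} ∈ 𝓝 u :=
    (isOpen_fiberParam_domain hφ).mem_nhds hu
  have hd : HasFDerivAt (fiberParam e φ H) (fderiv ℝ (fiberParam e φ H) u) u :=
    (((contDiffOn_fiberParam hφ hH hdet).contDiffAt hO).differentiableAt (by norm_num)).hasFDerivAt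
  set A := fderiv ℝ (fiberParam e φ H) u
  have hdr : HasFDerivAt (fun u => fiberParam e φ H u ∘ Sum.inr)
      ((ContinuousLinearMap.pi fun i => ContinuousLinearMap.proj (Sum.inr i)) ∘L A) u :=
    (ContinuousLinearMap.pi fun i => ContinuousLinearMap.proj (R := ℝ) (φ := fun _ : σ ⊕ σ => ℝ)
      (Sum.inr i)).hasFDerivAt.comp u hd
  have hl : HasFDerivAt (fun u : σ ⊕ Fin d → ℝ => u ∘ Sum.inl)
      (ContinuousLinearMap.pi fun i => ContinuousLinearMap.proj (R := ℝ)
        (φ := fun _ : σ ⊕ Fin d => ℝ) (Sum.inl i)) u :=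
    (ContinuousLinearMap.pi fun i => ContinuousLinearMap.proj (R := ℝ)
        (φ := fun _ : σ ⊕ Fin d => ℝ) (Sum.inl i)).hasFDerivAt
  have hφd : ∀ x, HasFDerivAt φ (fderiv ℝ φ x) x := fun x =>
    (hφ.differentiable (by norm_num) x).hasFDerivAt
  have c1 : ∀ w i, A w (Sum.inl i) = w (Sum.inl i) := by
    intro w i
    have h1 := (hasFDerivAt_pi'.1 hd) (Sum.inl i)
    have h2 : HasFDerivAt (fun u : σ ⊕ Fin d → ℝ => fiberParam e φ H u (Sum.inl i))
      (ContinuousLinearMap.proj (R := ℝ) (φ := fun _ : σ ⊕ Fin d => ℝ) (Sum.inl i)) u :=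
      (ContinuousLinearMap.proj (R := ℝ) (φ := fun _ : σ ⊕ Fin d => ℝ) (Sum.inl i)).hasFDerivAt
    exact congrArg (fun T => T w) (h1.unique h2)
  have c2 : ∀ w, L (fun i => A w (Sum.inr i)) = fun j => w (Sum.inr j) := by
    intro w
    have h1 := L.hasFDerivAt.comp u hdr
    have h2 : HasFDerivAt (fun u : σ ⊕ Fin d → ℝ => u ∘ Sum.inr)
      (ContinuousLinearMap.pi fun i => ContinuousLinearMap.proj (R := ℝ)
        (φ := fun _ : σ ⊕ Fin d => ℝ) (Sum.inr i)) u :=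
      (ContinuousLinearMap.pi fun i => ContinuousLinearMap.proj (R := ℝ)
        (φ := fun _ : σ ⊕ Fin d => ℝ) (Sum.inr i)).hasFDerivAt
    have h3 := h2.congr_of_eventuallyEq (f₁ := L ∘ fun u => fiberParam e φ H u ∘ Sum.inr)
      (by filter_upwards [hO] with v hv using (fiberParam_spec hH hv).2)
    exact congrArg (fun T => T w) (h1.unique h3)
  refine ⟨c1, c2, fun w => ?_⟩
  have h1 := (hφd (fiberParam e φ H u ∘ Sum.inr)).comp u hdr
  have h2 := (hφd (u ∘ Sum.inl)).comp u hl
  have h3 := h2.congr_of_eventuallyEq (f₁ := φ ∘ fun u => fiberParam e φ H u ∘ Sum.inr)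
    (by filter_upwards [hO] with v hv using (fiberParam_spec hH hv).1)
  have h4 := congrArg (fun T => T w) (h1.unique h3)
  refine h4.trans ?_
  simp only [c1]
  rfl

variable [DecidableEq σ]

/-- The matrix of the derivative. -/
noncomputable def jacobianMatrix (φ : (σ → ℝ) → (Fin N → ℝ)) (x : σ → ℝ) : Matrix (Fin N) σ ℝ :=
  LinearMap.toMatrix' (fderiv ℝ φ x : (σ → ℝ) →ₗ[ℝ] (Fin N → ℝ))

/-- The Gram determinant of `(x, y) ↦ φ x - φ y`. -/
noncomputable def pairGram (φ : (σ → ℝ) → (Fin N → ℝ)) (z : σ ⊕ σ → ℝ) : ℝ :=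
  (jacobianMatrix φ (z ∘ Sum.inl) * (jacobianMatrix φ (z ∘ Sum.inl))ᵀ +
    jacobianMatrix φ (z ∘ Sum.inr) * (jacobianMatrix φ (z ∘ Sum.inr))ᵀ).det

/-- Apply the area formula to the parametrization by (x, v). The integrand collapses to the chart
density at (φ(x), v), and integrating out v leaves the fiber density at φ(x). -/
theorem lintegral_fiberProduct_chart (hφ : ContDiff ℝ 1 φ)
    (hH : ∀ x, H x = glue e (φ x, L x))
    (hdet : ∀ x ∈ H.source, (glueDeriv e (fderiv ℝ φ x) L).det ≠ 0)
    {A B : Set (σ → ℝ)} (hA : MeasurableSet A) (hB : MeasurableSet B) (hBs : B ⊆ H.source) :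
    ∫⁻ z in WithLp.toLp 2 '' fiberProduct φ A B,
        ENNReal.ofReal (1 / √(pairGram φ z.ofLp)) ∂μHE[Fintype.card (σ ⊕ Fin d)] =
      ∫⁻ x in A, fiberDensity e φ L H B (φ x) := by
  set O : Set (σ ⊕ Fin d → ℝ) := {u | glue e (φ (u ∘ Sum.inl), u ∘ Sum.inr) ∈ H.target} with hO
  have hOo : IsOpen O := isOpen_fiberParam_domain hφ
  set S : Set (σ ⊕ Fin d → ℝ) :=
    {u | u ∘ Sum.inl ∈ A ∧ glue e (φ (u ∘ Sum.inl), u ∘ Sum.inr) ∈ H '' B} with hS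
  have hHB : MeasurableSet (H '' B) := measurableSet_chart_image hB hBs
  have hSO : S ⊆ O := by
    rintro u ⟨-, x, hx, hxu⟩
    change glue e _ ∈ H.target
    rw [← hxu]
    exact H.map_source (hBs hx)
  have hSm : MeasurableSet S := by
    refine MeasurableSet.inter ?_ ?_
    · exact (measurable_pi_lambda _ fun i => measurable_pi_apply _) hA
    · exact (contDiff_glue_param hφ).continuous.measurable hHB
  have hcd := contDiffOn_fiberParam (σ := σ) hφ hH hdet
  have himg : fiberParam e φ H '' S = fiberProduct φ A B := by
    ext z
    constructor
    · rintro ⟨u, hu, rfl⟩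
      refine ⟨hu.1, ?_, (fiberParam_spec hH (hSO hu)).1.symm⟩
      obtain ⟨x, hx, hxu⟩ := hu.2
      change H.symm (glue e _) ∈ B
      rw [← hxu, H.left_inv (hBs hx)]
      exact hx
    · rintro ⟨h1, h2, h3⟩
      refine ⟨Sum.elim (z ∘ Sum.inl) (L (z ∘ Sum.inr)), ⟨h1, ?_⟩, ?_⟩
      · refine ⟨z ∘ Sum.inr, h2, ?_⟩
        rw [hH, ← h3]
        simp only [Sum.elim_comp_inl, Sum.elim_comp_inr]
      · rw [fiberParam]
        simp only [Sum.elim_comp_inl, Sum.elim_comp_inr]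
        rw [h3, ← hH, H.left_inv (hBs h2), Sum.elim_comp_inl_inr]
  have hspec := fun u (hu : u ∈ S) => fderiv_fiberParam_spec hφ hH hdet (hSO hu)
  have hinjd : ∀ u ∈ S, Function.Injective (fderiv ℝ (fiberParam e φ H) u) := by
    intro u hu
    rw [injective_iff_map_eq_zero]
    intro w hw
    obtain ⟨c1, c2, -⟩ := hspec u hu
    have d1 := c1 w
    have d2 := c2 w
    rw [hw] at d1 d2
    ext (i | i)
    · exact (d1 i).symm
    · have h0 : L (fun i => (0 : σ ⊕ σ → ℝ) (Sum.inr i)) = 0 := L.map_zero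
      rw [h0] at d2
      exact (congrFun d2 i).symm
  have hinj : InjOn (fiberParam e φ H) S := by
    intro u hu w hw huw
    have h1 := (fiberParam_spec hH (hSO hu)).2
    have h2 := (fiberParam_spec hH (hSO hw)).2
    rw [huw, h2] at h1
    ext (i | i)
    · exact congrFun huw (Sum.inl i)
    · exact (congrFun h1 i).symm
  have key := lintegral_image_toLp_euclideanHausdorffMeasure (ψ := fiberParam e φ H)
    (ψ' := fderiv ℝ (fiberParam e φ H)) hSm
    (fun u hu => (hcd.contDiffAt (hOo.mem_nhds (hSO hu))).hasStrictFDerivAt (by norm_num))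
    ((hcd.continuousOn_fderiv_of_isOpen hOo (by norm_num)).mono hSO) hinjd hinj
    (fun z => ENNReal.ofReal (1 / √(pairGram φ z.ofLp)))
  rw [himg] at key
  rw [key]
  have hcm := measurable_chartDensity hφ hdet hB hBs
  have h1 : ∫⁻ u in S, ENNReal.ofReal
        √((LinearMap.toMatrix' (fderiv ℝ (fiberParam e φ H) u : (σ ⊕ Fin d → ℝ) →ₗ[ℝ] σ ⊕ σ → ℝ))ᵀ *
          LinearMap.toMatrix' (fderiv ℝ (fiberParam e φ H) u :
            (σ ⊕ Fin d → ℝ) →ₗ[ℝ] σ ⊕ σ → ℝ)).det *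
        ENNReal.ofReal (1 / √(pairGram φ (WithLp.toLp 2 (fiberParam e φ H u)).ofLp)) =
      ∫⁻ u in S, chartDensity e φ L H B (glue e (φ (u ∘ Sum.inl), u ∘ Sum.inr)) := by
    refine setLIntegral_congr_fun hSm fun u hu => ?_
    obtain ⟨c1, c2, c3⟩ := hspec u hu
    rw [chartDensity, Set.indicator_of_mem hu.2, ← ENNReal.ofReal_mul (Real.sqrt_nonneg _)]
    congr 1
    exact sqrt_det_mul_one_div_sqrt_det e (fderiv ℝ φ (u ∘ Sum.inl)) _ L
      (hdet _ (H.map_target (hSO hu))) _ c1 c2 c3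
  rw [h1]
  have hmp := volume_measurePreserving_sumPiEquivProdPi_symm (fun _ : σ ⊕ Fin d => ℝ)
  rw [← hmp.setLIntegral_comp_preimage_emb (MeasurableEquiv.measurableEmbedding _)]
  have hpre : (MeasurableEquiv.sumPiEquivProdPi fun _ : σ ⊕ Fin d => ℝ).symm ⁻¹' S =
      {p : (σ → ℝ) × (Fin d → ℝ) | p.1 ∈ A ∧ glue e (φ p.1, p.2) ∈ H '' B} := rfl
  rw [hpre]
  have hgm : Measurable fun p : (σ → ℝ) × (Fin d → ℝ) => glue e (φ p.1, p.2) :=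
    (glue e).continuous.measurable.comp
      ((hφ.continuous.measurable.comp measurable_fst).prodMk measurable_snd)
  -- The chart density vanishes off `H '' B`, so that constraint can be dropped and the domain
  -- becomes a product.
  have hset : ∫⁻ p in {p : (σ → ℝ) × (Fin d → ℝ) | p.1 ∈ A ∧ glue e (φ p.1, p.2) ∈ H '' B},
        chartDensity e φ L H B (glue e (φ p.1, p.2)) =
      ∫⁻ p in A ×ˢ (univ : Set (Fin d → ℝ)), chartDensity e φ L H B (glue e (φ p.1, p.2)) := by
    have : {p : (σ → ℝ) × (Fin d → ℝ) | p.1 ∈ A ∧ glue e (φ p.1, p.2) ∈ H '' B} =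
        (fun p : (σ → ℝ) × (Fin d → ℝ) => glue e (φ p.1, p.2)) ⁻¹' (H '' B) ∩
          A ×ˢ (univ : Set (Fin d → ℝ)) := by
      ext p; simp [and_comm]
    rw [this, ← setLIntegral_indicator (hgm hHB)]
    refine lintegral_congr fun p => ?_
    by_cases hp : p ∈ (fun p : (σ → ℝ) × (Fin d → ℝ) => glue e (φ p.1, p.2)) ⁻¹' (H '' B)
    · rw [Set.indicator_of_mem hp]
    · rw [Set.indicator_of_notMem hp, chartDensity,
        Set.indicator_of_notMem (mt Set.mem_preimage.2 hp)]
  refine (Eq.trans ?_ hset).trans ?_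
  · rfl
  · rw [Measure.volume_eq_prod, ← Measure.prod_restrict,
      lintegral_prod (fun p : (σ → ℝ) × (Fin d → ℝ) =>
        chartDensity e φ L H B (glue e (φ p.1, p.2))) (hcm.comp hgm).aemeasurable]
    simp only [Measure.restrict_univ]
    rfl

end FiberSurface

/-! ### From the charts to the whole fiber product -/

section FiberTheorem

open Matrix Set
open scoped ENNReal

/-- If `φ` is a submersion along `D`, the image of Lebesgue measure on `D` has a density, and the
integral of its square is a surface integral over the fiber product of `D` with itself. -/
theorem exists_density_lintegral_fiberProduct {σ : Type*} [Fintype σ] [DecidableEq σ] {N : ℕ}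
    (hN : N ≤ Fintype.card σ) {φ : (σ → ℝ) → (Fin N → ℝ)} (hφ : ContDiff ℝ 1 φ) {D : Set (σ → ℝ)}
    (hD : MeasurableSet D) (hsurj : ∀ x ∈ D, Function.Surjective (fderiv ℝ φ x)) :
    ∃ f : (Fin N → ℝ) → ℝ≥0∞, Measurable f ∧
      (volume.restrict D).map φ = volume.withDensity f ∧
      ∫⁻ z in WithLp.toLp 2 '' fiberProduct φ D D,
        ENNReal.ofReal (1 / √(pairGram φ z.ofLp)) ∂μHE[2 * Fintype.card σ - N] =
      ∫⁻ t, f t ^ 2 := by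
  have hφm : Measurable φ := hφ.continuous.measurable
  rcases D.eq_empty_or_nonempty with rfl | hne
  · refine ⟨0, measurable_zero, ?_, ?_⟩
    · simp
    · simp [fiberProduct]
  set d := Fintype.card σ - N with hd
  have hcard : Fintype.card (Fin N ⊕ Fin d) = Fintype.card σ := by
    simp only [Fintype.card_sum, Fintype.card_fin]; omega
  set e : Fin N ⊕ Fin d ≃ σ := Fintype.equivOfCardEq hcard
  have hdim : 2 * Fintype.card σ - N = Fintype.card (σ ⊕ Fin d) := by
    simp only [Fintype.card_sum, Fintype.card_fin]; omega
  rw [hdim]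
  have : Nonempty (OpenPartialHomeomorph (σ → ℝ) (σ → ℝ)) := ⟨OpenPartialHomeomorph.refl _⟩
  choose! L H hH hyH hdet using fun y (hy : y ∈ D) => exists_chart e hφ (hsurj y hy)
  obtain ⟨t, htD, htc, hcov⟩ := TopologicalSpace.countable_cover_nhdsWithin
    (f := fun y => (H y).source) (s := D)
    fun y hy => mem_nhdsWithin_of_mem_nhds ((H y).open_source.mem_nhds (hyH y hy))
  have htne : t.Nonempty := by
    obtain ⟨x, hx⟩ := hne
    obtain ⟨i, hi, -⟩ := mem_iUnion₂.1 (hcov hx)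
    exact ⟨i, hi⟩
  obtain ⟨c, rfl⟩ := htc.exists_eq_range htne
  have hcD : ∀ n, c n ∈ D := fun n => htD (mem_range_self n)
  set B : ℕ → Set (σ → ℝ) := disjointed fun n => (H (c n)).source ∩ D with hBdef
  have hBm : ∀ n, MeasurableSet (B n) := fun n =>
    MeasurableSet.disjointed (fun n => (H (c n)).open_source.measurableSet.inter hD) n
  have hBU : ⋃ n, B n = D := by
    rw [hBdef, iUnion_disjointed, ← iUnion_inter, inter_eq_right]
    intro x hx
    obtain ⟨i, hi, hxi⟩ := mem_iUnion₂.1 (hcov hx)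
    obtain ⟨n, rfl⟩ := hi
    exact mem_iUnion.2 ⟨n, hxi⟩
  have hBsub : ∀ n, B n ⊆ (H (c n)).source := fun n =>
    (disjointed_subset _ n).trans inter_subset_left
  have hdis : Pairwise (Function.onFun Disjoint B) := disjoint_disjointed _
  set f : ℕ → (Fin N → ℝ) → ℝ≥0∞ := fun n => fiberDensity e φ (L (c n)) (H (c n)) (B n) with hf
  have hfm : ∀ n, Measurable (f n) := fun n =>
    measurable_fiberDensity hφ (hdet _ (hcD n)) (hBm n) (hBsub n)
  have hmap : ∀ n, (volume.restrict (B n)).map φ = volume.withDensity (f n) := fun n =>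
    map_restrict_eq_withDensity_fiberDensity hφ (hH _ (hcD n)) (hdet _ (hcD n)) (hBm n) (hBsub n)
  have hFm : Measurable fun t => ∑' n, f n t := Measurable.tsum hfm
  have hFmap : (volume.restrict D).map φ = volume.withDensity fun t => ∑' n, f n t := by
    have h1 : (fun t => ∑' n, f n t) = ∑' n, f n := by
      ext t
      rw [ENNReal.tsum_apply]
    rw [h1, withDensity_tsum hfm, ← hBU, Measure.restrict_iUnion hdis hBm,
      Measure.map_sum hφm.aemeasurable]
    simp only [hmap]
  refine ⟨fun t => ∑' n, f n t, hFm, hFmap, ?_⟩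
  -- Only the second factor is cut into pieces. The first stays all of `D`, so with F = Σ f_n the
  -- pieces sum to ∫_D F(φ(x)) dx, which is ∫ F² because F is the density of the image measure.
  have himgU : WithLp.toLp 2 '' fiberProduct φ D D =
      ⋃ n, (WithLp.toLp 2 '' fiberProduct φ D (B n) : Set (EuclideanSpace ℝ (σ ⊕ σ))) := by
    rw [← image_iUnion]
    congr 1
    ext z
    simp only [fiberProduct, mem_ofPred_eq, mem_iUnion]
    conv_lhs => rw [show (z ∘ Sum.inr ∈ D) = ∃ n, z ∘ Sum.inr ∈ B n by rw [← hBU, mem_iUnion]]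
    constructor
    · rintro ⟨h1, ⟨n, h2⟩, h3⟩
      exact ⟨n, h1, h2, h3⟩
    · rintro ⟨n, h1, h2, h3⟩
      exact ⟨h1, ⟨n, h2⟩, h3⟩
  have hfpm : ∀ A B : Set (σ → ℝ), MeasurableSet A → MeasurableSet B →
      MeasurableSet (WithLp.toLp 2 '' fiberProduct φ A B : Set (EuclideanSpace ℝ (σ ⊕ σ))) := by
    intro A B hA hB
    refine (MeasurableEquiv.toLp 2 (σ ⊕ σ → ℝ)).measurableEmbedding.measurableSet_image.2 ?_
    have hl : Measurable fun z : σ ⊕ σ → ℝ => z ∘ Sum.inl :=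
      measurable_pi_lambda _ fun i => measurable_pi_apply _
    have hr : Measurable fun z : σ ⊕ σ → ℝ => z ∘ Sum.inr :=
      measurable_pi_lambda _ fun i => measurable_pi_apply _
    exact (hl hA).inter ((hr hB).inter
      (measurableSet_eq_fun (hφm.comp hl) (hφm.comp hr)))
  rw [himgU, lintegral_iUnion (fun n => hfpm _ _ hD (hBm n))]
  · have hone : ∀ n, ∫⁻ z in WithLp.toLp 2 '' fiberProduct φ D (B n),
        ENNReal.ofReal (1 / √(pairGram φ z.ofLp)) ∂μHE[Fintype.card (σ ⊕ Fin d)] =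
        ∫⁻ x in D, f n (φ x) := fun n =>
      lintegral_fiberProduct_chart hφ (hH _ (hcD n)) (hdet _ (hcD n)) hD (hBm n) (hBsub n)
    simp only [hone]
    rw [← lintegral_tsum (f := fun n x => f n (φ x)) fun n => ((hfm n).comp hφm).aemeasurable,
      ← lintegral_map (f := fun t => ∑' n, f n t) hFm hφm, hFmap,
      lintegral_withDensity_eq_lintegral_mul _ hFm hFm]
    simp only [Pi.mul_apply, sq]
  · intro i j hij
    refine (disjoint_image_iff (WithLp.toLp_injective 2)).2 (Set.disjoint_left.2 ?_)
    intro z hz hz'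
    exact Set.disjoint_left.1 (hdis hij) hz.2.1 hz'.2.1

end FiberTheorem

/-! ### Plancherel for integrable functions -/

section Plancherel

open scoped FourierTransform SchwartzMap ENNReal

variable {E : Type*} [NormedAddCommGroup E] [InnerProductSpace ℝ E] [FiniteDimensional ℝ E]
  [MeasurableSpace E] [BorelSpace E]

theorem ae_eq_of_integral_schwartz_smul_eq {f g : E → ℂ} (hf : LocallyIntegrable f)
    (hg : LocallyIntegrable g) (h : ∀ u : 𝓢(E, ℂ), ∫ x, u x • f x = ∫ x, u x • g x) :
    f =ᵐ[volume] g := by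
  refine ae_eq_of_integral_contDiff_smul_eq hf hg fun u hu hus => ?_
  have hus' : HasCompactSupport (fun x => (u x : ℂ)) :=
    hus.comp_left (g := fun t : ℝ => (t : ℂ)) Complex.ofReal_zero
  simp only [Complex.real_smul]
  have := h (hus'.toSchwartzMap (Complex.ofRealCLM.contDiff.comp hu))
  exact this

theorem integral_fourier_schwartz_smul {f : E → ℂ} (hf : Integrable f) (u : 𝓢(E, ℂ)) :
    ∫ x, (𝓕 u) x • f x = ∫ x, u x • 𝓕 f x := by
  rw [SchwartzMap.fourier_coe]
  simpa using! (VectorFourier.integral_fourierIntegral_smul_eq_flip (L := innerₗ E)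
    Real.continuous_fourierChar continuous_inner u.integrable hf)

theorem continuous_fourier_of_integrable {f : E → ℂ} (hf : Integrable f) : Continuous (𝓕 f) :=
  VectorFourier.fourierIntegral_continuous Real.continuous_fourierChar
    (by exact continuous_inner) hf

/-- The Fourier integral and the L² Fourier transform pair equally with Schwartz functions, hence
agree almost everywhere; the isometry on L² then applies. -/
theorem eLpNorm_fourier_eq_of_memLp {f : E → ℂ} (hf : Integrable f) (hf2 : MemLp f 2) :
    eLpNorm (𝓕 f) 2 = eLpNorm f 2 := by
  set F : Lp (α := E) ℂ 2 volume := hf2.toLp f with hF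
  have key : 𝓕 f =ᵐ[volume] (𝓕 F : Lp (α := E) ℂ 2 volume) := by
    refine ae_eq_of_integral_schwartz_smul_eq
      (continuous_fourier_of_integrable hf).locallyIntegrable
      ((Lp.memLp (𝓕 F)).locallyIntegrable (by norm_num)) fun u => ?_
    have h1 := congrArg (fun T => T u) (Lp.fourier_toTemperedDistribution_eq F)
    simp only [TemperedDistribution.fourier_apply, Lp.toTemperedDistribution_apply] at h1
    rw [← h1, ← integral_fourier_schwartz_smul hf]
    refine integral_congr_ae ?_
    filter_upwards [hf2.coeFn_toLp] with x hx
    rw [hF, hx]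
  rw [eLpNorm_congr_ae key, ← eLpNorm_congr_ae hf2.coeFn_toLp]
  have := Lp.norm_fourier_eq F
  rw [Lp.norm_def, Lp.norm_def,
    ENNReal.toReal_eq_toReal_iff' (Lp.eLpNorm_ne_top _) (Lp.eLpNorm_ne_top _)] at this
  exact this

/-- As a distribution, `f` is the L² inverse transform of `𝓕 f`. This shows that both norms in
Plancherel become infinite together. -/
theorem memLp_two_of_memLp_two_fourier {f : E → ℂ} (hf : Integrable f) (hf2 : MemLp (𝓕 f) 2) :
    MemLp f 2 := by
  set F : Lp (α := E) ℂ 2 volume := hf2.toLp (𝓕 f) with hF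
  have key : f =ᵐ[volume] (𝓕⁻ F : Lp (α := E) ℂ 2 volume) := by
    refine ae_eq_of_integral_schwartz_smul_eq hf.locallyIntegrable
      ((Lp.memLp (𝓕⁻ F)).locallyIntegrable (by norm_num)) fun u => ?_
    have h1 := congrArg (fun T => T u) (Lp.fourierInv_toTemperedDistribution_eq F)
    simp only [TemperedDistribution.fourierInv_apply, Lp.toTemperedDistribution_apply] at h1
    rw [← h1]
    have h2 := integral_fourier_schwartz_smul hf (𝓕⁻ u)
    rw [FourierTransform.fourier_fourierInv_eq] at h2
    rw [h2]
    refine integral_congr_ae ?_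
    filter_upwards [hf2.coeFn_toLp] with x hx
    rw [hF, hx]
  exact (Lp.memLp _).ae_eq key.symm

/-- Plancherel's theorem for integrable functions, with both sides possibly infinite. -/
theorem eLpNorm_fourier_eq {f : E → ℂ} (hf : Integrable f) :
    eLpNorm (𝓕 f) 2 = eLpNorm f 2 := by
  by_cases h : MemLp f 2
  · exact eLpNorm_fourier_eq_of_memLp hf h
  · have h' : ¬ MemLp (𝓕 f) 2 := fun H => h (memLp_two_of_memLp_two_fourier hf H)
    have e1 : eLpNorm f 2 = ⊤ := by
      by_contra H
      exact h ⟨hf.aestronglyMeasurable, lt_top_iff_ne_top.2 H⟩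
    have e2 : eLpNorm (𝓕 f) 2 = ⊤ := by
      by_contra H
      exact h' ⟨(continuous_fourier_of_integrable hf).aestronglyMeasurable, lt_top_iff_ne_top.2 H⟩
    rw [e1, e2]

end Plancherel

/-! ### The special integral as the squared L² norm of a density -/

section ThetaDensity

open scoped FourierTransform ENNReal

variable {N r : ℕ}

/-- The polynomial map `(x₁, …, x_k) ↦ (γⱼ(x₁) + ⋯ + γⱼ(x_k))ⱼ`. -/
noncomputable def halfMap (K : Matrix (Fin N) (Fin r) ℕ) (k : ℕ) (x : Fin k × Fin r → ℝ)
    (j : Fin N) : ℝ :=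
  MvPolynomial.eval x (halfSystem K k j)

theorem halfMap_apply (K : Matrix (Fin N) (Fin r) ℕ) (k : ℕ) (x : Fin k × Fin r → ℝ)
    (j : Fin N) : halfMap K k x j = ∑ i, ∏ s, x (i, s) ^ K j s := by
  simp [halfMap, halfSystem, gammaAt, map_sum, map_prod]

theorem contDiff_halfMap (K : Matrix (Fin N) (Fin r) ℕ) (k : ℕ) : ContDiff ℝ 1 (halfMap K k) := by
  rw [contDiff_pi]
  intro j
  simp only [halfMap_apply]
  refine ContDiff.sum fun i _ => contDiff_prod fun s _ => (contDiff_apply _ _ _).pow _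

theorem volume_restrict_Icc_eq_pi {ι : Type*} [Fintype ι] :
    (volume : Measure (ι → ℝ)).restrict (Set.Icc 0 1) =
      Measure.pi fun _ => (volume : Measure ℝ).restrict (Set.Icc 0 1) := by
  rw [← Measure.restrict_pi_pi, ← Set.pi_univ_Icc]
  rfl

theorem measurePreserving_uncurry_pi {ι κ : Type*} [Fintype ι] [Fintype κ] (μ : Measure ℝ)
    [SigmaFinite μ] :
    MeasurePreserving (Function.uncurry : (ι → κ → ℝ) → (ι × κ → ℝ))
      (Measure.pi fun _ => Measure.pi fun _ => μ) (Measure.pi fun _ => μ) := by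
  have hm : Measurable (Function.uncurry : (ι → κ → ℝ) → (ι × κ → ℝ)) := measurable_uncurry
  refine ⟨hm, (Measure.pi_eq fun s hs => ?_).symm⟩
  rw [Measure.map_apply hm (MeasurableSet.univ_pi hs)]
  have : (Function.uncurry : (ι → κ → ℝ) → (ι × κ → ℝ)) ⁻¹' (Set.univ.pi s) =
      Set.univ.pi fun i => Set.univ.pi fun j => s (i, j) := by
    ext x
    simp [Set.mem_pi]
  rw [this, Measure.pi_pi]
  simp only [Measure.pi_pi]
  rw [Fintype.prod_prod_type]

theorem measurePreserving_uncurry_cube {ι κ : Type*} [Fintype ι] [Fintype κ] :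
    MeasurePreserving (Function.uncurry : (ι → κ → ℝ) → (ι × κ → ℝ))
      (Measure.pi fun _ => (volume : Measure (κ → ℝ)).restrict (Set.Icc 0 1))
      ((volume : Measure (ι × κ → ℝ)).restrict (Set.Icc 0 1)) := by
  rw [volume_restrict_Icc_eq_pi, volume_restrict_Icc_eq_pi]
  exact measurePreserving_uncurry_pi _

theorem integral_exp_phase_pow (K : Matrix (Fin N) (Fin r) ℕ) (k : ℕ) (α : Fin N → ℝ) :
    (∫ x in Set.Icc (0 : Fin r → ℝ) 1,
      Complex.exp (2 * Real.pi * Complex.I * (phase K α x : ℂ))) ^ k =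
    ∫ x in Set.Icc (0 : Fin k × Fin r → ℝ) 1,
      Complex.exp (2 * Real.pi * Complex.I * ((∑ j, α j * halfMap K k x j : ℝ) : ℂ)) := by
  have hmp := measurePreserving_uncurry_cube (ι := Fin k) (κ := Fin r)
  have h1 := integral_fintype_prod_eq_pow (ι := Fin k)
    (μ := (volume : Measure (Fin r → ℝ)).restrict (Set.Icc 0 1))
    (fun x => Complex.exp (2 * Real.pi * Complex.I * (phase K α x : ℂ)))
  rw [Fintype.card_fin] at h1
  rw [← h1, ← hmp.map_eq, integral_map hmp.measurable.aemeasurable]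
  · refine integral_congr_ae (ae_of_all _ fun x => ?_)
    beta_reduce
    rw [← Complex.exp_sum, ← Finset.mul_sum, ← Complex.ofReal_sum]
    congr 3
    simp only [phase, halfMap_apply, Finset.mul_sum, Function.uncurry_apply_pair]
    rw [Finset.sum_comm]
  · refine Continuous.aestronglyMeasurable ?_
    have := (contDiff_halfMap K k).continuous
    fun_prop

theorem lintegral_enorm_sq_eq_eLpNorm_sq {X : Type*} [MeasurableSpace X] (μ : Measure X)
    (g : X → ℂ) : ∫⁻ x, ‖g x‖ₑ ^ 2 ∂μ = eLpNorm g 2 μ ^ 2 := by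
  have := eLpNorm_nnreal_pow_eq_lintegral (f := g) (μ := μ) (p := 2) (by norm_num)
  simpa using this.symm

/-- The image of the cube has finite mass, so `f` is integrable and its Fourier transform is the
k-th power of the trigonometric integral. Plancherel holds with infinite values allowed, so
convergence of θ_k is not needed. -/
theorem theta_eq_lintegral_sq (K : Matrix (Fin N) (Fin r) ℕ) (k : ℕ) {f : (Fin N → ℝ) → ℝ≥0∞}
    (hf : Measurable f)
    (hmap : (volume.restrict (Set.Icc (0 : Fin k × Fin r → ℝ) 1)).map (halfMap K k) =
      volume.withDensity f) :
    theta K k = ∫⁻ t, f t ^ 2 := by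
  have hcm : Measurable (halfMap K k) := (contDiff_halfMap K k).continuous.measurable
  have hmass : ∫⁻ t, f t ≠ ⊤ := by
    have h1 := congrArg (fun μ : Measure (Fin N → ℝ) => μ Set.univ) hmap
    simp only [withDensity_apply _ MeasurableSet.univ, Measure.restrict_univ] at h1
    rw [← h1, Measure.map_apply hcm MeasurableSet.univ]
    simp [isCompact_Icc.measure_lt_top.ne]
  have hlt : ∀ᵐ t, f t < ⊤ := ae_lt_top hf hmass
  set F : EuclideanSpace ℝ (Fin N) → ℂ := fun ξ => ((f ξ.ofLp).toReal : ℂ) with hF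
  have hmp := PiLp.volume_preserving_ofLp (Fin N)
  have hmp' := PiLp.volume_preserving_toLp (Fin N)
  have hFm : AEStronglyMeasurable F :=
    (Complex.measurable_ofReal.comp
      (hf.ennreal_toReal.comp hmp.measurable)).aestronglyMeasurable
  have hFn : ∀ᵐ ξ : EuclideanSpace ℝ (Fin N), ‖F ξ‖ₑ = f ξ.ofLp := by
    filter_upwards [hmp.quasiMeasurePreserving.ae hlt] with ξ hξ
    rw [hF]
    simp only [← ofReal_norm, Complex.norm_real, Real.norm_of_nonneg ENNReal.toReal_nonneg]
    exact ENNReal.ofReal_toReal hξ.ne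
  have hFi : Integrable F := by
    refine ⟨hFm, ?_⟩
    rw [HasFiniteIntegral, lintegral_congr_ae hFn, hmp.lintegral_comp hf]
    exact lt_top_iff_ne_top.2 hmass
  -- The sign of α is reversed because `𝓕` integrates against e^{−2πi⟨·,·⟩}.
  have key : ∀ α : Fin N → ℝ, (∫ x in Set.Icc (0 : Fin r → ℝ) 1,
      Complex.exp (2 * Real.pi * Complex.I * (phase K α x : ℂ))) ^ k =
      𝓕 F (WithLp.toLp 2 (-α)) := by
    intro α
    have hg : AEStronglyMeasurable (fun t : Fin N → ℝ =>
        Complex.exp (2 * Real.pi * Complex.I * ((∑ j, α j * t j : ℝ) : ℂ)))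
        ((volume.restrict (Set.Icc (0 : Fin k × Fin r → ℝ) 1)).map (halfMap K k)) := by
      refine Continuous.aestronglyMeasurable ?_
      fun_prop
    rw [integral_exp_phase_pow, ← integral_map hcm.aemeasurable hg, hmap,
      integral_withDensity_eq_integral_toReal_smul hf hlt, Real.fourier_eq',
      ← hmp'.integral_comp (MeasurableEquiv.toLp 2 (Fin N → ℝ)).measurableEmbedding]
    refine integral_congr_ae (ae_of_all _ fun t => ?_)
    simp only [hF, PiLp.inner_apply, Complex.real_smul, smul_eq_mul]
    rw [mul_comm]
    congr 2
    simp only [Pi.neg_apply, RCLike.inner_apply, conj_trivial, Complex.ofReal_mul,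
      Complex.ofReal_sum, Complex.ofReal_neg, neg_mul, Finset.sum_neg_distrib]
    push_cast
    ring
  have h2 : theta K k = ∫⁻ α : Fin N → ℝ, ‖𝓕 F (WithLp.toLp 2 (-α))‖ₑ ^ 2 := by
    rw [theta]
    refine lintegral_congr fun α => ?_
    rw [← key, enorm_pow, ← pow_mul, mul_comm k 2]
  have hcF : Continuous (𝓕 F) := continuous_fourier_of_integrable hFi
  have hcF' : Measurable fun ξ => ‖𝓕 F ξ‖ₑ ^ 2 := (hcF.measurable.enorm).pow_const 2
  rw [h2, (Measure.measurePreserving_neg (volume : Measure (Fin N → ℝ))).lintegral_comp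
    (f := fun α => ‖𝓕 F (WithLp.toLp 2 α)‖ₑ ^ 2) (hcF'.comp hmp'.measurable),
    hmp'.lintegral_comp hcF', lintegral_enorm_sq_eq_eLpNorm_sq, eLpNorm_fourier_eq hFi,
    ← lintegral_enorm_sq_eq_eLpNorm_sq, ← hmp.lintegral_comp (hf.pow_const 2)]
  refine lintegral_congr_ae ?_
  filter_upwards [hFn] with ξ hξ
  rw [hξ]

end ThetaDensity

/-! ### Zero sets of nonzero polynomials are null -/

section PolynomialZeros

/-- View `p` as a polynomial in the first variable. By induction some coefficient is nonzero at
almost every value of the other variables; the slice is then finite, and Fubini concludes. -/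
theorem volume_zeros_eq_zero_fin {n : ℕ} {p : MvPolynomial (Fin n) ℝ} (hp : p ≠ 0) :
    volume {x : Fin n → ℝ | MvPolynomial.eval x p = 0} = 0 := by
  induction n with
  | zero =>
    have : {x : Fin 0 → ℝ | MvPolynomial.eval x p = 0} = ∅ := by
      ext x
      simp only [Set.mem_ofPred_eq, Set.mem_empty_iff_false, iff_false]
      intro h
      refine hp (MvPolynomial.funext fun y => ?_)
      rw [Subsingleton.elim y x, h, map_zero]
    rw [this, measure_empty]
  | succ n ih =>
    set S : Set (Fin (n + 1) → ℝ) := {x | MvPolynomial.eval x p = 0}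
    have hS : MeasurableSet S :=
      (isClosed_singleton.preimage (MvPolynomial.continuous_eval p)).measurableSet
    set T : Set ((Fin n → ℝ) × ℝ) := {z | MvPolynomial.eval (Fin.cons z.2 z.1) p = 0} with hT
    have hmp := (volume_preserving_piFinSuccAbove (fun _ : Fin (n + 1) => ℝ) 0)
    have hsw : MeasurePreserving (Prod.swap : ℝ × (Fin n → ℝ) → (Fin n → ℝ) × ℝ) :=
      Measure.measurePreserving_swap
    have hcomp := hsw.comp hmp
    have hcont : Continuous fun z : (Fin n → ℝ) × ℝ =>
        MvPolynomial.eval (Fin.cons z.2 z.1 : Fin (n + 1) → ℝ) p := by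
      refine (MvPolynomial.continuous_eval p).comp (continuous_pi fun i => ?_)
      refine Fin.cases ?_ (fun i => ?_) i
      · simpa using continuous_snd
      · simp only [Fin.cons_succ]
        fun_prop
    have hTm : MeasurableSet T := (isClosed_singleton.preimage hcont).measurableSet
    have hpre : (Prod.swap ∘ MeasurableEquiv.piFinSuccAbove (fun _ : Fin (n + 1) => ℝ) 0) ⁻¹' T =
        S := by
      ext x
      change MvPolynomial.eval (Fin.cons (x 0) (fun i : Fin n => x (Fin.succAbove 0 i))) p = 0 ↔ _
      have : (Fin.cons (x 0) (fun i : Fin n => x (Fin.succAbove 0 i)) : Fin (n + 1) → ℝ) = x := by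
        ext i
        refine Fin.cases ?_ (fun i => ?_) i <;> simp
      rw [this]
      rfl
    rw [← hpre, hcomp.measure_preimage hTm.nullMeasurableSet, Measure.volume_eq_prod,
      Measure.measure_prod_null hTm]
    set q := MvPolynomial.finSuccEquiv ℝ n p with hq
    have hq0 : q ≠ 0 := by
      rw [hq]
      simpa using hp
    obtain ⟨i, hi⟩ : ∃ i, q.coeff i ≠ 0 := by
      by_contra! H
      exact hq0 (Polynomial.ext fun i => by rw [H i, Polynomial.coeff_zero])
    have hae : ∀ᵐ s : Fin n → ℝ, MvPolynomial.eval s (q.coeff i) ≠ 0 := by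
      rw [ae_iff]
      simpa using ih hi
    filter_upwards [hae] with s hs
    have hne : Polynomial.map (MvPolynomial.eval s) q ≠ 0 := by
      intro h0
      have := congrArg (fun u => Polynomial.coeff u i) h0
      simp only [Polynomial.coeff_map, Polynomial.coeff_zero] at this
      exact hs this
    have hfin : (Prod.mk s ⁻¹' T) ⊆ {y | (Polynomial.map (MvPolynomial.eval s) q).IsRoot y} := by
      intro y hy
      have hy' : MvPolynomial.eval (Fin.cons y s) p = 0 := hy
      rw [MvPolynomial.eval_eq_eval_mv_eval'] at hy'
      exact hy'
    exact ((Polynomial.finite_setOfPred_isRoot hne).subset hfin).measure_zero _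

theorem volume_zeros_eq_zero {σ : Type*} [Fintype σ] {p : MvPolynomial σ ℝ} (hp : p ≠ 0) :
    volume {x : σ → ℝ | MvPolynomial.eval x p = 0} = 0 := by
  set e := Fintype.equivFin σ
  have hp' : MvPolynomial.rename e p ≠ 0 := fun h =>
    hp (MvPolynomial.rename_injective e e.injective (by rw [h, map_zero]))
  have hmp := volume_measurePreserving_piCongrLeft (fun _ : σ => ℝ) e.symm
  have hm : MeasurableSet {x : σ → ℝ | MvPolynomial.eval x p = 0} :=
    (isClosed_singleton.preimage (MvPolynomial.continuous_eval p)).measurableSet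
  rw [← hmp.measure_preimage hm.nullMeasurableSet, ← volume_zeros_eq_zero_fin hp']
  congr 1
  ext x
  simp only [Set.mem_preimage, Set.mem_ofPred_eq, MvPolynomial.eval_rename]
  have : (MeasurableEquiv.piCongrLeft (fun _ : σ => ℝ) e.symm) x = x ∘ e := by
    ext i
    obtain ⟨j, rfl⟩ := e.symm.surjective i
    simp only [MeasurableEquiv.coe_piCongrLeft, Equiv.piCongrLeft_apply_apply,
      Function.comp_apply, Equiv.apply_symm_apply]
  rw [this]

end PolynomialZeros

/-! ### Jacobian of the half system and the first Gram determinant -/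

section PolynomialDerivative

open Matrix

theorem hasFDerivAt_eval {σ : Type*} [Fintype σ] (p : MvPolynomial σ ℝ) (x : σ → ℝ) :
    HasFDerivAt (fun y => MvPolynomial.eval y p)
      (∑ v, MvPolynomial.eval x (MvPolynomial.pderiv v p) •
        ContinuousLinearMap.proj (R := ℝ) (φ := fun _ : σ => ℝ) v) x := by
  classical
  induction p using MvPolynomial.induction_on with
  | C a =>
    simp only [MvPolynomial.eval_C, MvPolynomial.pderiv_C, map_zero, zero_smul,
      Finset.sum_const_zero]
    exact hasFDerivAt_const a x
  | add p q hp hq =>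
    simp only [map_add, add_smul, Finset.sum_add_distrib]
    exact hp.add hq
  | mul_X p i hp =>
    have h := hp.mul (ContinuousLinearMap.proj (R := ℝ) (φ := fun _ : σ => ℝ) i).hasFDerivAt
    simp only [map_mul, MvPolynomial.eval_X]
    convert! h using 1
    ext w
    simp only [MvPolynomial.pderiv_mul, MvPolynomial.pderiv_X, map_add, map_mul,
      MvPolynomial.eval_X, _root_.sum_apply, _root_.smul_apply,
      ContinuousLinearMap.proj_apply, _root_.add_apply, smul_eq_mul, add_mul,
      Finset.sum_add_distrib, Finset.mul_sum]
    rw [add_comm]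
    congr 1
    · rw [Finset.sum_eq_single i]
      · simp
      · intro v _ hv
        simp [Ne.symm hv]
      · simp
    · exact Finset.sum_congr rfl fun v _ => by ring

variable {N r : ℕ}

/-- The Jacobian matrix of the half system at a point. -/
noncomputable def halfJacobian (K : Matrix (Fin N) (Fin r) ℕ) (k : ℕ) (x : Fin k × Fin r → ℝ) :
    Matrix (Fin N) (Fin k × Fin r) ℝ :=
  (jacobian (halfSystem K k)).map (MvPolynomial.eval x)

theorem jacobianMatrix_halfMap (K : Matrix (Fin N) (Fin r) ℕ) (k : ℕ) (x : Fin k × Fin r → ℝ) :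
    jacobianMatrix (halfMap K k) x = halfJacobian K k x := by
  ext j v
  have h := (contDiff_halfMap K k).differentiable (by norm_num) x
  have h1 := (hasFDerivAt_pi'.1 h.hasFDerivAt) j
  have h2 := h1.unique (hasFDerivAt_eval (halfSystem K k j) x)
  rw [jacobianMatrix, LinearMap.toMatrix'_apply]
  have h3 := congrArg (fun T => T (Pi.single v 1)) h2
  simp only [ContinuousLinearMap.comp_apply, ContinuousLinearMap.proj_apply,
    _root_.sum_apply, _root_.smul_apply, smul_eq_mul] at h3
  rw [ContinuousLinearMap.coe_coe]
  refine h3.trans ?_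
  rw [Finset.sum_eq_single v]
  · simp [halfJacobian, jacobian]
  · intro w _ hw
    simp [hw]
  · simp

theorem eval_gramDet {m n σ : Type} [Fintype m] [DecidableEq m] [Fintype n]
    (A : Matrix m n (MvPolynomial σ ℝ)) (x : σ → ℝ) :
    MvPolynomial.eval x (gramDet A) =
      (A.map (MvPolynomial.eval x) * (A.map (MvPolynomial.eval x))ᵀ).det := by
  rw [gramDet, RingHom.map_det, RingHom.mapMatrix_apply, Matrix.map_mul, transpose_map]

theorem eval_Phi_one (K : Matrix (Fin N) (Fin r) ℕ) (k : ℕ) (x : Fin k × Fin r → ℝ) :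
    MvPolynomial.eval x (Phi K k 1) = (halfJacobian K k x * (halfJacobian K k x)ᵀ).det :=
  eval_gramDet _ x

theorem eval_Phi_nonneg (K : Matrix (Fin N) (Fin r) ℕ) (k l : ℕ) (x : Fin k × Fin r → ℝ) :
    0 ≤ MvPolynomial.eval x (Phi K k l) := by
  rcases l with _ | _ | l
  · simp [Phi]
  · rw [Phi, eval_gramDet]; exact det_mul_transpose_nonneg _
  · rw [Phi, eval_gramDet]; exact det_mul_transpose_nonneg _

theorem surjective_fderiv_halfMap {K : Matrix (Fin N) (Fin r) ℕ} {k : ℕ} {x : Fin k × Fin r → ℝ}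
    (hx : MvPolynomial.eval x (Phi K k 1) ≠ 0) :
    Function.Surjective (fderiv ℝ (halfMap K k) x) := by
  rw [eval_Phi_one, ← jacobianMatrix_halfMap] at hx
  intro t
  set J := jacobianMatrix (halfMap K k) x with hJ
  have hu : IsUnit (J * Jᵀ) := (Matrix.isUnit_iff_isUnit_det _).2 (isUnit_iff_ne_zero.2 hx)
  obtain ⟨v, hv⟩ := (Matrix.mulVec_surjective_iff_isUnit.2 hu) t
  refine ⟨Jᵀ *ᵥ v, ?_⟩
  rw [← mulVec_mulVec] at hv
  exact (LinearMap.toMatrix'_mulVec _ _).symm.trans hv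

/-- The exponents of the monomial `γⱼ` in the `i`-th group of variables. -/
noncomputable def groupExponent {ι : Type} (K : Matrix (Fin N) (Fin r) ℕ) (j : Fin N) (i : ι) :
    ι × Fin r →₀ ℕ :=
  ∑ s, Finsupp.single (i, s) (K j s)

theorem gammaAt_eq_monomial {ι : Type} (K : Matrix (Fin N) (Fin r) ℕ) (j : Fin N) (i : ι) :
    gammaAt K j i = MvPolynomial.monomial (groupExponent K j i) 1 := by
  rw [gammaAt, groupExponent, MvPolynomial.monomial_sum_one]
  simp only [MvPolynomial.X_pow_eq_monomial]

theorem groupExponent_same {ι : Type} (K : Matrix (Fin N) (Fin r) ℕ) (j : Fin N) (i : ι)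
    (s : Fin r) : groupExponent K j i (i, s) = K j s := by
  classical
  simp [groupExponent, Finsupp.finsetSum_apply, Finsupp.single_apply]

theorem groupExponent_of_ne {ι : Type} (K : Matrix (Fin N) (Fin r) ℕ) (j : Fin N) {i i' : ι}
    (h : i' ≠ i) (s : Fin r) : groupExponent K j i (i', s) = 0 := by
  classical
  simp [groupExponent, Finsupp.finsetSum_apply, h.symm]

theorem pderiv_gammaAt_of_ne {ι : Type} (K : Matrix (Fin N) (Fin r) ℕ) (j : Fin N) {i i' : ι}
    (h : i' ≠ i) (s : Fin r) : MvPolynomial.pderiv (i', s) (gammaAt K j i) = 0 := by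
  rw [gammaAt_eq_monomial, MvPolynomial.pderiv_monomial, groupExponent_of_ne K j h]
  simp

theorem halfJacobian_apply (K : Matrix (Fin N) (Fin r) ℕ) (k : ℕ) (x : Fin k × Fin r → ℝ)
    (j : Fin N) (i : Fin k) (s : Fin r) :
    halfJacobian K k x j (i, s) =
      MvPolynomial.eval x (MvPolynomial.pderiv (i, s) (gammaAt K j i)) := by
  simp only [halfJacobian, jacobian, halfSystem, Matrix.map_apply, Matrix.of_apply, map_sum]
  rw [Finset.sum_eq_single i]
  · intro i' _ hi'
    rw [pderiv_gammaAt_of_ne K j hi'.symm, map_zero]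
  · simp

/-- The operator x ∂/∂x multiplies a monomial by its exponent. Unlike the bare derivative, it needs
no exponent subtraction. -/
theorem mul_halfJacobian_apply (K : Matrix (Fin N) (Fin r) ℕ) (k : ℕ) (x : Fin k × Fin r → ℝ)
    (j : Fin N) (i : Fin k) (s : Fin r) :
    x (i, s) * halfJacobian K k x j (i, s) = (∏ t, x (i, t) ^ K j t) * K j s := by
  rw [halfJacobian_apply, gammaAt_eq_monomial]
  have h1 : MvPolynomial.eval x (MvPolynomial.monomial (groupExponent K j i) 1) =
      ∏ t, x (i, t) ^ K j t := by
    rw [← gammaAt_eq_monomial]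
    simp [gammaAt, map_prod]
  rw [← h1, MvPolynomial.pderiv_monomial, groupExponent_same]
  rcases Nat.eq_zero_or_pos (K j s) with h0 | h0
  · simp [h0]
  · have h2 : groupExponent K j i =
        Finsupp.single (i, s) 1 + (groupExponent K j i - Finsupp.single (i, s) 1) := by
      rw [add_tsub_cancel_of_le]
      rw [Finsupp.single_le_iff, groupExponent_same]
      exact h0
    have h3 : MvPolynomial.X (R := ℝ) (i, s) *
        MvPolynomial.monomial (groupExponent K j i - Finsupp.single (i, s) 1) (1 * (K j s : ℝ)) =
        MvPolynomial.monomial (groupExponent K j i) 1 * MvPolynomial.C (K j s : ℝ) := by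
      rw [MvPolynomial.X, MvPolynomial.monomial_mul, ← h2, mul_comm _ (MvPolynomial.C _),
        MvPolynomial.C_mul_monomial]
      simp
    have := congrArg (MvPolynomial.eval x) h3
    simpa only [map_mul, MvPolynomial.eval_X, MvPolynomial.eval_C] using this

/-- Multiplying the columns of the Jacobian by the coordinates of `x` can only enlarge its left
kernel, so it is enough that the scaled matrix has none. This holds even when coordinates vanish. -/
theorem eval_Phi_one_ne_zero {K : Matrix (Fin N) (Fin r) ℕ} {k : ℕ} {x : Fin k × Fin r → ℝ}
    (h : ∀ c : Fin N → ℝ, (∀ i s, ∑ j, c j * ((∏ t, x (i, t) ^ K j t) * K j s) = 0) → c = 0) :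
    MvPolynomial.eval x (Phi K k 1) ≠ 0 := by
  rw [eval_Phi_one, det_mul_transpose_ne_zero_iff]
  intro c hc
  refine h c fun i s => ?_
  have h1 := congrFun hc (i, s)
  simp only [Matrix.vecMul, dotProduct, Pi.zero_apply] at h1
  calc _ = x (i, s) * ∑ j, c j * halfJacobian K k x j (i, s) := by
        rw [Finset.mul_sum]
        refine Finset.sum_congr rfl fun j _ => ?_
        rw [← mul_halfJacobian_apply]; ring
    _ = 0 := by rw [h1, mul_zero]

/-- Each monomial is a single variable, so the Jacobian is constant. This serves the degree-one
instance of case (b), where no condition Φ_j ≥ λ is imposed. -/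
theorem halfJacobian_of_degree_one {K : Matrix (Fin N) (Fin r) ℕ} (hK : ∀ j, ∑ s, K j s = 1)
    (k : ℕ) (x : Fin k × Fin r → ℝ) (j : Fin N) (i : Fin k) (s : Fin r) :
    halfJacobian K k x j (i, s) = K j s := by
  rw [halfJacobian_apply, gammaAt_eq_monomial, MvPolynomial.pderiv_monomial, groupExponent_same]
  rcases Nat.eq_zero_or_pos (K j s) with h0 | h0
  · simp [h0]
  · have hz : groupExponent K j i - Finsupp.single (i, s) 1 = 0 := by
      classical
      ext ⟨i', t⟩
      rcases eq_or_ne i' i with rfl | hi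
      · rw [Finsupp.tsub_apply, groupExponent_same, Finsupp.single_apply]
        by_cases hst : s = t
        · subst hst
          have := Finset.single_le_sum (f := K j) (fun _ _ => Nat.zero_le _) (Finset.mem_univ s)
          simp only [if_true, Finsupp.coe_zero, Pi.zero_apply]
          rw [hK] at this
          omega
        · have := Finset.add_le_sum (f := K j) (fun _ _ => Nat.zero_le _) (Finset.mem_univ s)
            (Finset.mem_univ t) hst
          rw [hK] at this
          simp only [Finsupp.coe_zero, Pi.zero_apply]
          omega
      · rw [Finsupp.tsub_apply, groupExponent_of_ne K j hi]
        simp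
    rw [hz]
    simp

end PolynomialDerivative

/-! ### The monomial order realized by integer weights -/

section MonomialOrder

/-- The value of the base `M` number with digits `a`, the first digit being the leading one. -/
def digitValue (M : ℕ) {r : ℕ} (a : Fin r → ℕ) : ℕ :=
  ∑ s : Fin r, M ^ (r - 1 - (s : ℕ)) * a s

theorem digitValue_succ (M : ℕ) {r : ℕ} (a : Fin (r + 1) → ℕ) :
    digitValue M a = M ^ r * a 0 + digitValue M (fun s => a s.succ) := by
  simp only [digitValue]
  rw [Fin.sum_univ_succ]
  congr 1
  refine Finset.sum_congr rfl fun s _ => ?_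
  congr 2
  simp only [Fin.val_succ]
  omega

theorem digitValue_lt (M : ℕ) {r : ℕ} {a : Fin r → ℕ} (ha : ∀ s, a s < M) :
    digitValue M a < M ^ r := by
  induction r with
  | zero => simp [digitValue]
  | succ r ih =>
    rw [digitValue_succ]
    have h1 := ih fun s => ha s.succ
    have h2 : M ^ r * (a 0 + 1) ≤ M ^ r * M := Nat.mul_le_mul_left _ (ha 0)
    rw [pow_succ]
    linarith

theorem digitValue_lt_of_lex (M : ℕ) {r : ℕ} {a b : Fin r → ℕ} (ha : ∀ s, a s < M)
    (h : toLex a < toLex b) : digitValue M a < digitValue M b := by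
  induction r with
  | zero =>
    obtain ⟨i, -⟩ := h
    exact i.elim0
  | succ r ih =>
    obtain ⟨i, hi, hlt⟩ := h
    rw [digitValue_succ, digitValue_succ]
    induction i using Fin.cases with
    | zero =>
      have h1 := digitValue_lt M fun s => ha s.succ
      have h2 : M ^ r * (a 0 + 1) ≤ M ^ r * b 0 := Nat.mul_le_mul_left _ hlt
      linarith
    | succ i =>
      have h0 : a 0 = b 0 := hi 0 (Fin.succ_pos i)
      have h1 : toLex (fun s : Fin r => a s.succ) < toLex (fun s : Fin r => b s.succ) :=
        ⟨i, fun j hj => hi j.succ (Fin.succ_lt_succ_iff.2 hj), hlt⟩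
      have h2 := ih (fun s => ha s.succ) h1
      rw [h0]
      linarith

/-- The base M exceeds every exponent, so a row read as a number in base M respects the
lexicographic order and stays below M^r. Adding M^r to each weight lets the total degree dominate.
-/
theorem exists_weights_strictMono {N r : ℕ} {K : Matrix (Fin N) (Fin r) ℕ} (hord : NLOrdered K) :
    ∃ w : Fin r → ℕ, ∀ i j : Fin N, i < j → ∑ s, w s * K i s < ∑ s, w s * K j s := by
  set M : ℕ := (∑ i, ∑ s, K i s) + 1 with hM
  have hb : ∀ i s, K i s < M := fun i s => by
    have h1 := Finset.single_le_sum (f := K i) (fun _ _ => Nat.zero_le _) (Finset.mem_univ s)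
    have h2 : ∑ s, K i s ≤ ∑ i, ∑ s, K i s :=
      Finset.single_le_sum (f := fun i => ∑ s, K i s) (fun _ _ => Nat.zero_le _)
        (Finset.mem_univ i)
    omega
  refine ⟨fun s => M ^ r + M ^ (r - 1 - (s : ℕ)), fun i j hij => ?_⟩
  have he : ∀ i, ∑ s : Fin r, (M ^ r + M ^ (r - 1 - (s : ℕ))) * K i s =
      M ^ r * ∑ s, K i s + digitValue M (K i) := fun i => by
    simp only [add_mul, Finset.sum_add_distrib, digitValue, Finset.mul_sum]
  rw [he, he]
  rcases hord i j hij with h | ⟨h, hlex⟩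
  · have h1 := digitValue_lt M (hb i)
    have h2 : M ^ r * (∑ s, K i s + 1) ≤ M ^ r * ∑ s, K j s := Nat.mul_le_mul_left _ h
    linarith
  · rw [h]
    have := digitValue_lt_of_lex M (hb i) hlex
    linarith

end MonomialOrder

/-! ### Nonvanishing of Φ_1 from the block structure -/

section BlockStructure

open Matrix

theorem linearIndependent_rows_of_blockRank {N r : ℕ} {K : Matrix (Fin N) (Fin r) ℕ} {a b ρ : ℕ}
    (hab : a + ρ = b) (h : blockRank K a b = ρ) :
    LinearIndependent ℝ (fun i : {i : Fin N // a ≤ i.val ∧ i.val < b} => realMatrix K i.val) := by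
  rw [linearIndependent_iff_card_eq_finrank_span]
  have h1 : Fintype.card {i : Fin N // a ≤ i.val ∧ i.val < b} ≤ ρ := by
    have : Function.Injective
        (fun i : {i : Fin N // a ≤ i.val ∧ i.val < b} =>
          (⟨i.val.val, Finset.mem_Ico.2 i.2⟩ : Finset.Ico a b)) := by
      intro i j hij
      simp only [Subtype.mk.injEq] at hij
      exact Subtype.ext (Fin.ext hij)
    have := Fintype.card_le_of_injective _ this
    simp only [Fintype.card_coe, Nat.card_Ico] at this
    omega
  rw [blockRank, rank_eq_finrank_span_row] at h
  have h2 : (Set.range fun i : {i : Fin N // a ≤ i.val ∧ i.val < b} => realMatrix K i.val) =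
      Set.range ((realMatrix K).submatrix
        (fun i : {i : Fin N // a ≤ i.val ∧ i.val < b} => i.val) id).row := rfl
  refine le_antisymm (h1.trans ?_) (finrank_range_le_card _)
  rw [h2, Set.finrank, h]

/-- Full row rank is the nonvanishing of a Gram determinant, hence an open condition, and persists
from t = 0 to small t > 0. -/
theorem exists_small_parameter {N : ℕ} {C : Type*} [Fintype C] (M : ℝ → Matrix (Fin N) C ℝ)
    (hM : ∀ i j, Continuous fun t => M t i j) (h0 : ∀ v, v ᵥ* M 0 = 0 → v = 0) :
    ∃ t, 0 < t ∧ ∀ v, v ᵥ* M t = 0 → v = 0 := by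
  have hc : Continuous M := continuous_matrix hM
  have hdet : Continuous fun t => (M t * (M t)ᵀ).det :=
    (hc.matrix_mul hc.matrix_transpose).matrix_det
  have hev : ∀ᶠ t in 𝓝 (0 : ℝ), (M t * (M t)ᵀ).det ≠ 0 :=
    hdet.continuousAt.eventually_ne ((det_mul_transpose_ne_zero_iff _).2 h0)
  obtain ⟨t, ht, ht0⟩ :=
    ((hev.filter_mono nhdsWithin_le_nhds).and (self_mem_nhdsWithin (s := Set.Ioi (0 : ℝ)))).exists
  exact ⟨t, ht0, (det_mul_transpose_ne_zero_iff _).1 ht⟩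

/-- Induct downwards over the blocks. With the parameters of the later blocks fixed, the next one is
taken small: after rescaling rows and columns, the matrix at t = 0 is block triangular, with the
independent rows of the current block and the system already treated on its diagonal. -/
theorem exists_separating_parameters {N r q : ℕ} (V : Matrix (Fin N) (Fin r) ℝ) {e : Fin N → ℕ}
    (he : StrictMono e) (cut : Fin (q + 1) → ℕ) (hlast : cut (Fin.last q) = N)
    (hcut : ∀ m : Fin q, cut m.castSucc ≤ cut m.succ)
    (hind : ∀ (m : Fin q) (c : Fin N → ℝ),
      (∀ j : Fin N, ¬ (cut m.castSucc ≤ j.val ∧ j.val < cut m.succ) → c j = 0) →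
      (∀ s, ∑ j, c j * V j s = 0) → c = 0) (m : Fin (q + 1)) :
    ∃ T : Fin q → ℝ, ∀ c : Fin N → ℝ, (∀ j : Fin N, j.val < cut m → c j = 0) →
      (∀ i : Fin q, m ≤ i.castSucc → ∀ s, ∑ j, c j * (T i ^ (2 * e j) * V j s) = 0) → c = 0 := by
  induction m using Fin.reverseInduction with
  | last =>
    refine ⟨0, fun c hc _ => funext fun j => hc j ?_⟩
    rw [hlast]; exact j.2
  | cast m ih =>
    obtain ⟨T, hT⟩ := ih
    by_cases hne : ∃ j : Fin N, cut m.castSucc ≤ j.val ∧ j.val < cut m.succ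
    swap
    · refine ⟨T, fun c hc hc' => hT c (fun j hj => ?_) fun i hi => hc' i ?_⟩
      · by_contra h
        refine hne ⟨j, ?_, hj⟩
        by_contra hlt
        exact h (hc j (not_le.1 hlt))
      · exact (Fin.castSucc_lt_succ (i := m)).le.trans hi
    obtain ⟨j₀, hj₀, hj₀'⟩ := hne
    -- the exponent separating the block from the later rows
    obtain ⟨E, hE1, hE2⟩ : ∃ E, (∀ j : Fin N, j.val < cut m.succ → 2 * e j < E) ∧
        (∀ j : Fin N, cut m.succ ≤ j.val → E < 2 * e j) := by
      classical
      set S := Finset.univ.filter fun j : Fin N => j.val < cut m.succ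
      refine ⟨2 * S.sup e + 1, fun j hj => ?_, fun j hj => ?_⟩
      · have : e j ≤ S.sup e := Finset.le_sup (by simpa [S] using hj)
        omega
      · have h1 : S.sup e < e j := by
          have hpos : 0 < e j := by
            have : j₀ < j := Fin.lt_def.2 (lt_of_lt_of_le hj₀' hj)
            exact lt_of_le_of_lt (Nat.zero_le _) (he this)
          rw [Finset.sup_lt_iff hpos]
          intro i hi
          refine he (Fin.lt_def.2 (lt_of_lt_of_le ?_ hj))
          simpa [S] using hi
        omega
    -- Rows of the current block are scaled by t^(E − 2e_j), and the columns belonging to its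
    -- parameter t by t^(−E), so all exponents are nonnegative and t = 0 is allowed. The columns
    -- indexed by `Fin N` force the coefficients of earlier rows to vanish.
    set M : ℝ → Matrix (Fin N) ((Fin r ⊕ (Fin q × Fin r)) ⊕ Fin N) ℝ := fun t => Matrix.of fun j c =>
      Sum.elim (Sum.elim
        (fun s => if j.val < cut m.castSucc then 0
          else (if j.val < cut m.succ then 1 else t ^ (2 * e j - E)) * V j s)
        (fun p => if j.val < cut m.castSucc ∨ ¬ m.succ ≤ p.1.castSucc then 0
          else (if j.val < cut m.succ then t ^ (E - 2 * e j) else 1) *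
            (T p.1 ^ (2 * e j) * V j p.2)))
        (fun j' => if j = j' ∧ j.val < cut m.castSucc then 1 else 0) c with hM
    have hmask : ∀ t v, v ᵥ* M t = 0 → ∀ j : Fin N, j.val < cut m.castSucc → v j = 0 := by
      intro t v hv j hj
      have h1 := congrFun hv (Sum.inr j)
      simp only [Matrix.vecMul, dotProduct, hM, Matrix.of_apply, Sum.elim_inr, Pi.zero_apply] at h1
      rw [Finset.sum_eq_single j] at h1
      · simpa [hj] using h1
      · intro i _ hi
        simp [hi]
      · simp
    have hcont : ∀ i j, Continuous fun t => M t i j := by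
      intro j c
      rcases c with (s | p) | j'
      · simp only [hM, Matrix.of_apply, Sum.elim_inl]
        split_ifs <;> fun_prop
      · simp only [hM, Matrix.of_apply, Sum.elim_inl, Sum.elim_inr]
        split_ifs <;> fun_prop
      · simp only [hM, Matrix.of_apply, Sum.elim_inr]
        exact continuous_const
    have h0 : ∀ v, v ᵥ* M 0 = 0 → v = 0 := by
      intro v hv
      have hm := hmask 0 v hv
      have hblock : (fun j : Fin N => if j.val < cut m.succ then v j else 0) = 0 := by
        refine hind m _ (fun j hj => ?_) fun s => ?_
        · by_cases hj' : j.val < cut m.succ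
          · have : j.val < cut m.castSucc := by
              by_contra h
              exact hj ⟨not_lt.1 h, hj'⟩
            simp [hm j this]
          · simp [hj']
        · have h1 := congrFun hv (Sum.inl (Sum.inl s))
          simp only [Matrix.vecMul, dotProduct, hM, Matrix.of_apply, Sum.elim_inl,
            Pi.zero_apply] at h1
          refine Eq.trans (Finset.sum_congr rfl fun j _ => ?_) h1
          by_cases hj : j.val < cut m.castSucc
          · simp [hm j hj]
          · by_cases hj' : j.val < cut m.succ
            · simp [hj, hj']
            · have := hE2 j (not_lt.1 hj')
              have hz : (0 : ℝ) ^ (2 * e j - E) = 0 := zero_pow (by omega)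
              simp [hj, hj', hz]
      have hb : ∀ j : Fin N, j.val < cut m.succ → v j = 0 := fun j hj => by
        simpa [hj] using congrFun hblock j
      refine hT v hb fun i hi s => ?_
      have h1 := congrFun hv (Sum.inl (Sum.inr (i, s)))
      simp only [Matrix.vecMul, dotProduct, hM, Matrix.of_apply, Sum.elim_inl, Sum.elim_inr,
        Pi.zero_apply] at h1
      refine Eq.trans (Finset.sum_congr rfl fun j _ => ?_) h1
      by_cases hj : j.val < cut m.succ
      · simp [hb j hj]
      · have hj' : ¬ j.val < cut m.castSucc := fun h => hj (lt_of_lt_of_le h (hcut m))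
        simp [hj, hj', hi]
    obtain ⟨t, ht, hker⟩ := exists_small_parameter M hcont h0
    refine ⟨Function.update T m t, fun c hc hc' => ?_⟩
    -- Undo the row scaling: a relation between the original rows becomes a left kernel vector of `M
    -- t`.
    set v : Fin N → ℝ := fun j =>
      if j.val < cut m.succ then c j / t ^ (E - 2 * e j) else c j with hv
    have hv0 : v = 0 := by
      refine hker v (funext fun col => ?_)
      rcases col with (s | ⟨i, s⟩) | j'
      · have h1 := hc' m le_rfl s
        simp only [Function.update_self] at h1
        simp only [Matrix.vecMul, dotProduct, hM, Matrix.of_apply, Sum.elim_inl, Pi.zero_apply]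
        have h2 : t ^ E * ∑ j, v j * (if j.val < cut m.castSucc then 0
            else (if j.val < cut m.succ then 1 else t ^ (2 * e j - E)) * V j s) = 0 := by
          rw [Finset.mul_sum]
          refine Eq.trans (Finset.sum_congr rfl fun j _ => ?_) h1
          by_cases hj : j.val < cut m.castSucc
          · simp [hj, hc j hj]
          · by_cases hj' : j.val < cut m.succ
            · have h3 : t ^ E = t ^ (2 * e j) * t ^ (E - 2 * e j) := by
                rw [← pow_add]; congr 1; have := hE1 j hj'; omega
              have h4 : t ^ (E - 2 * e j) ≠ 0 := pow_ne_zero _ ht.ne'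
              simp only [hv, hj, hj', if_true, if_false, h3]
              field_simp
            · have h3 : t ^ (2 * e j) = t ^ E * t ^ (2 * e j - E) := by
                rw [← pow_add]; congr 1; have := hE2 j (not_lt.1 hj'); omega
              simp only [hv, hj, hj', if_false, h3]
              ring
        exact (mul_eq_zero.1 h2).resolve_left (pow_ne_zero _ ht.ne')
      · simp only [Matrix.vecMul, dotProduct, hM, Matrix.of_apply, Sum.elim_inl, Sum.elim_inr,
          Pi.zero_apply]
        by_cases hi : m.succ ≤ i.castSucc
        · have him : i ≠ m := by
            rintro rfl
            exact absurd hi (not_le.2 Fin.castSucc_lt_succ)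
          have h1 := hc' i ((Fin.castSucc_lt_succ (i := m)).le.trans hi) s
          rw [Function.update_of_ne him] at h1
          refine Eq.trans (Finset.sum_congr rfl fun j _ => ?_) h1
          by_cases hj : j.val < cut m.castSucc
          · simp [hj, hc j hj]
          · by_cases hj' : j.val < cut m.succ
            · have h4 : t ^ (E - 2 * e j) ≠ 0 := pow_ne_zero _ ht.ne'
              simp only [hv, hj, hj', hi, not_true, or_false, if_true, if_false]
              field_simp
            · simp [hv, hj, hj', hi]
        · simp [hi]
      · simp only [Matrix.vecMul, dotProduct, hM, Matrix.of_apply, Sum.elim_inr, Pi.zero_apply]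
        refine Finset.sum_eq_zero fun j _ => ?_
        by_cases hj : j.val < cut m.castSucc
        · simp [hv, hc j hj]
        · simp [hj]
    funext j
    have h1 := congrFun hv0 j
    simp only [hv, Pi.zero_apply] at h1 ⊢
    split_ifs at h1 with hj
    · exact (div_eq_zero_iff.1 h1).resolve_right (pow_ne_zero _ ht.ne')
    · exact h1

/-- At the point x_{i,s} = T_i^{2w_s} the j-th monomial of group i equals T_i^{2e_j}, where e_j is
the weight of row j. The scaled Jacobian thus contains the matrix of `exists_separating_parameters`.
-/
theorem Phi_one_ne_zero {N r q : ℕ} {K : Matrix (Fin N) (Fin r) ℕ} (hord : NLOrdered K)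
    {str : Fin q → ℕ} (hstr : HasStructure K str) {k : ℕ} (hkq : q ≤ k) : Phi K k 1 ≠ 0 := by
  obtain ⟨w, hw⟩ := exists_weights_strictMono hord
  obtain ⟨cut, h0, hlast, hblock⟩ := hstr
  obtain ⟨T, hT⟩ := exists_separating_parameters (realMatrix K)
    (e := fun j => ∑ s, w s * K j s) (fun i j hij => hw i j hij) cut hlast
    (fun m => (hblock m).1.le) (by
      intro m c hc hsum
      have hli := linearIndependent_rows_of_blockRank (hblock m).2.1 (hblock m).2.2.1
      rw [Fintype.linearIndependent_iff] at hli
      have h1 := hli (fun i => c i.val) (by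
        ext s
        simp only [Finset.sum_apply, Pi.smul_apply, smul_eq_mul, Pi.zero_apply]
        refine Eq.trans ?_ (hsum s)
        have h2 : ∑ j ∈ Finset.univ.filter
            (fun i : Fin N => cut m.castSucc ≤ i.val ∧ i.val < cut m.succ),
            c j * realMatrix K j s = ∑ j, c j * realMatrix K j s :=
          Finset.sum_filter_of_ne fun j _ hne => by_contra fun h => hne (by rw [hc j h, zero_mul])
        rw [← h2, Finset.sum_subtype _
          (p := fun i : Fin N => cut m.castSucc ≤ i.val ∧ i.val < cut m.succ) (by simp)])
      funext j
      by_cases hj : cut m.castSucc ≤ j.val ∧ j.val < cut m.succ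
      · exact h1 ⟨j, hj⟩
      · exact hc j hj) 0
  -- The groups beyond the q-th are arbitrary; their columns are not needed for the rank.
  set x : Fin k × Fin r → ℝ := fun p => if h : p.1.val < q then T ⟨p.1.val, h⟩ ^ (2 * w p.2) else 0
    with hx
  intro hzero
  refine eval_Phi_one_ne_zero (K := K) (x := x) (fun c hc => ?_) (by rw [hzero, map_zero])
  refine hT c (fun j hj => by rw [h0] at hj; omega) fun i _ s => ?_
  refine Eq.trans (Finset.sum_congr rfl fun j _ => ?_) (hc ⟨i.val, i.2.trans_le hkq⟩ s)
  congr 2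
  simp only [hx, i.2, dif_pos]
  rw [Finset.mul_sum, ← Finset.prod_pow_eq_pow_sum]
  refine Finset.prod_congr rfl fun s _ => ?_
  rw [← pow_mul, mul_assoc]

end BlockStructure

/-! ### Nonvanishing of the higher Gram determinants -/

section HigherGram

open Matrix

theorem iterPderiv_sum {σ ι : Type} {l : ℕ} (β : Fin l → σ) (S : Finset ι)
    (f : ι → MvPolynomial σ ℝ) : iterPderiv β (∑ i ∈ S, f i) = ∑ i ∈ S, iterPderiv β (f i) := by
  simp only [iterPderiv]
  induction List.ofFn β with
  | nil => simp
  | cons v L ih => simp only [List.foldr_cons, ih, map_sum]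

theorem iterPderiv_snoc {σ : Type} {l : ℕ} (β : Fin l → σ) (v : σ) (f : MvPolynomial σ ℝ) :
    iterPderiv (Fin.snoc β v : Fin (l + 1) → σ) f = iterPderiv β (MvPolynomial.pderiv v f) := by
  have : List.ofFn (Fin.snoc β v : Fin (l + 1) → σ) = List.ofFn β ++ [v] := by
    rw [List.ofFn_succ']
    simp
  rw [iterPderiv, this, List.foldr_append]
  rfl

theorem iterPderiv_zero {σ : Type} {l : ℕ} (β : Fin l → σ) :
    iterPderiv β (0 : MvPolynomial σ ℝ) = 0 := by
  simpa using iterPderiv_sum β (∅ : Finset Unit) (fun _ => 0)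

theorem iterPderiv_eq_zero {σ : Type} {l : ℕ} (β : Fin (l + 1) → σ) {f : MvPolynomial σ ℝ}
    (h : MvPolynomial.pderiv (β (Fin.last l)) f = 0) : iterPderiv β f = 0 := by
  rw [← Fin.snoc_init_self β, iterPderiv_snoc, h, iterPderiv_zero]

theorem eval_one_monomial {σ : Type} (a : σ →₀ ℕ) (b : ℝ) :
    MvPolynomial.eval (1 : σ → ℝ) (MvPolynomial.monomial a b) = b := by
  simp [MvPolynomial.eval_monomial, Finsupp.prod]

/-- A combination of the first order derivatives of all derivatives of order `l + 1` of a monomial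
vanishes at `(1, …, 1)` only if the coefficients of its variables vanish. -/
theorem coeff_eq_zero_of_sum_iterPderiv_monomial {σ : Type} [Fintype σ] (l : ℕ) :
    ∀ (a : σ →₀ ℕ) {b : ℝ} (_ : b ≠ 0) (c : σ → ℝ) (u : σ) (_ : 0 < a u) (_ : l + 2 ≤ ∑ v, a v)
      (_ : ∀ β : Fin (l + 1) → σ, (∀ t, 0 < a (β t)) →
        ∑ v, c v * MvPolynomial.eval 1
          (MvPolynomial.pderiv v (iterPderiv β (MvPolynomial.monomial a b))) = 0), c u = 0 := by
  classical
  induction l with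
  | zero =>
    intro a b hb c u hu ha h
    set L := ∑ v, c v * a v with hL
    -- At (1,…,1) the relation for ∂_w reads b·a_w·(L − c_w) = 0. So `c` equals L on every variable
    -- of the monomial, whence L = (deg)·L, and degree at least 2 forces L = 0.
    have key : ∀ w, 0 < a w → c w = L := by
      intro w hw
      have h1 := h (fun _ => w) fun _ => hw
      have h2 : ∀ v, c v * MvPolynomial.eval 1 (MvPolynomial.pderiv v
          (iterPderiv (fun _ : Fin 1 => w) (MvPolynomial.monomial a b))) =
          b * a w * (c v * a v) - b * a w * (if v = w then c v else 0) := by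
        intro v
        have h3 : iterPderiv (fun _ : Fin 1 => w) (MvPolynomial.monomial a b) =
          MvPolynomial.pderiv w (MvPolynomial.monomial a b) := by simp [iterPderiv]
        rw [h3, MvPolynomial.pderiv_monomial, MvPolynomial.pderiv_monomial, eval_one_monomial,
          Finsupp.tsub_apply, Finsupp.single_apply]
        by_cases hvw : v = w
        · subst hvw
          simp only [if_true]
          rw [Nat.cast_sub hw]
          push_cast
          ring
        · simp only [hvw, Ne.symm hvw, if_false, Nat.sub_zero]
          ring
      simp only [h2, Finset.sum_sub_distrib, ← Finset.mul_sum] at h1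
      rw [Finset.sum_ite_eq' Finset.univ w, if_pos (Finset.mem_univ _), ← mul_sub] at h1
      have h4 : b * a w ≠ 0 := mul_ne_zero hb (by exact_mod_cast hw.ne')
      have h5 := (mul_eq_zero.1 h1).resolve_left h4
      linarith
    have h6 : L = (∑ v, a v : ℕ) * L := by
      conv_lhs => rw [hL]
      rw [Nat.cast_sum, Finset.sum_mul]
      refine Finset.sum_congr rfl fun v _ => ?_
      rcases Nat.eq_zero_or_pos (a v) with h0 | h0
      · simp [h0]
      · rw [key v h0]; ring
    have h7 : (2 : ℝ) ≤ (∑ v, a v : ℕ) := by exact_mod_cast ha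
    have h8 : L = 0 := by
      have : ((∑ v, a v : ℕ) - 1 : ℝ) * L = 0 := by linarith
      exact (mul_eq_zero.1 this).resolve_left (by linarith)
    rw [key u hu, h8]
  | succ l ih =>
    intro a b hb c u hu ha h
    -- One derivative is spent so that `u` survives in the monomial: differentiate in `u` itself if
    -- its exponent is at least 2, otherwise in another variable, which exists by the degree bound.
    obtain ⟨v, hv, hvu⟩ : ∃ v, 0 < a v ∧ 0 < (a - Finsupp.single v 1 : σ →₀ ℕ) u := by
      by_cases h2 : 2 ≤ a u
      · refine ⟨u, hu, ?_⟩
        rw [Finsupp.tsub_apply, Finsupp.single_eq_same]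
        omega
      · have h1 : a u = 1 := by omega
        have h3 : ∃ v, v ≠ u ∧ 0 < a v := by
          by_contra! H
          have : ∑ v, a v = a u := by
            refine Finset.sum_eq_single u (fun v _ hv => ?_) (by simp)
            exact Nat.le_zero.1 (H v hv)
          omega
        obtain ⟨v, hvu, hv⟩ := h3
        refine ⟨v, hv, ?_⟩
        rw [Finsupp.tsub_apply, Finsupp.single_apply, if_neg hvu]
        omega
    have hadd : a = (a - Finsupp.single v 1) + Finsupp.single v 1 := by
      rw [tsub_add_cancel_of_le]
      rw [Finsupp.single_le_iff]
      exact hv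
    refine ih (a - Finsupp.single v 1) (b := b * a v)
      (mul_ne_zero hb (by exact_mod_cast hv.ne')) c u hvu ?_ ?_
    · have h1 : ∑ w, a w = ∑ w, (a - Finsupp.single v 1 : σ →₀ ℕ) w + 1 := by
        conv_lhs => rw [hadd]
        simp only [Finsupp.add_apply, Finset.sum_add_distrib]
        congr 1
        simp [Finsupp.single_apply]
      omega
    · intro β hβ
      have h1 := h (Fin.snoc β v) fun t => by
        refine Fin.lastCases ?_ (fun t => ?_) t
        · simpa using hv
        · have h2 := hβ t
          rw [Finsupp.tsub_apply] at h2
          simp only [Fin.snoc_castSucc]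
          omega
      simpa only [iterPderiv_snoc, MvPolynomial.pderiv_monomial] using h1

/-- Evaluate at (1,…,1). To kill the coefficient of the variable x_{i,s}, take a top-degree monomial
containing x_s and differentiate only in variables of group i; every other group drops out and one
monomial remains. -/
theorem Phi_higher_ne_zero {N r : ℕ} {K : Matrix (Fin N) (Fin r) ℕ}
    (hsen : SeniorFormContainsAll K) (k : ℕ) {l : ℕ} (hl : l + 2 ≤ degree K) :
    Phi K k (l + 2) ≠ 0 := by
  have key : MvPolynomial.eval 1 (Phi K k (l + 2)) ≠ 0 := by
    rw [Phi, eval_gramDet, det_mul_transpose_ne_zero_iff]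
    intro c hc
    funext ⟨i, s⟩
    obtain ⟨j, hj, hjs⟩ := hsen s
    have hpos : ∀ p : Fin k × Fin r, 0 < groupExponent K j i p → p.1 = i := by
      rintro ⟨i', t⟩ hp
      by_contra hi
      rw [groupExponent_of_ne K j hi] at hp
      exact lt_irrefl _ hp
    refine coeff_eq_zero_of_sum_iterPderiv_monomial l (groupExponent K j i) one_ne_zero c (i, s)
      (by rwa [groupExponent_same]) ?_ ?_
    · rw [Fintype.sum_prod_type, Finset.sum_eq_single i]
      · simp only [groupExponent_same]
        rw [hj]; exact hl
      · intro i' _ hi'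
        exact Finset.sum_eq_zero fun t _ => groupExponent_of_ne K j hi' t
      · simp
    · intro β hβ
      have h1 := congrFun hc (j, β)
      simp only [Matrix.vecMul, dotProduct, Matrix.map_apply, phiHigher, Matrix.transpose_apply,
        jacobian, Matrix.of_apply, Pi.zero_apply] at h1
      have h2 : iterPderiv β (halfSystem K k j) =
          iterPderiv β (MvPolynomial.monomial (groupExponent K j i) 1) := by
        rw [halfSystem, iterPderiv_sum, Finset.sum_eq_single i, gammaAt_eq_monomial]
        · intro i' _ hi'
          refine iterPderiv_eq_zero β ?_
          have h3 := hpos _ (hβ (Fin.last l))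
          have h4 : β (Fin.last l) = (i, (β (Fin.last l)).2) := Prod.ext h3 rfl
          rw [h4]
          exact pderiv_gammaAt_of_ne K j hi'.symm _
        · simp
      rw [h2] at h1
      exact h1
  intro h
  rw [h, map_zero] at key
  exact key rfl

end HigherGram

/-! ### The surface integral and its limit -/

section SurfaceIntegral

open Matrix
open scoped ENNReal

variable {N r : ℕ}

theorem halfSystem_rename {ι : Type} (K : Matrix (Fin N) (Fin r) ℕ) (k : ℕ) (j : Fin N)
    (g : Fin k → ι) :
    MvPolynomial.rename (Prod.map g id) (halfSystem K k j) = ∑ i, gammaAt K j (g i) := by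
  simp [halfSystem, gammaAt, map_sum, map_prod]

theorem system_eq_rename (K : Matrix (Fin N) (Fin r) ℕ) (k : ℕ) (j : Fin N) :
    system K k j = MvPolynomial.rename (Prod.map Sum.inl id) (halfSystem K k j) -
      MvPolynomial.rename (Prod.map Sum.inr id) (halfSystem K k j) := by
  rw [halfSystem_rename, halfSystem_rename, system]

theorem eval_system (K : Matrix (Fin N) (Fin r) ℕ) (k : ℕ) (j : Fin N)
    (z : (Fin k ⊕ Fin k) × Fin r → ℝ) :
    MvPolynomial.eval z (system K k j) = halfMap K k (z ∘ Prod.map Sum.inl id) j -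
      halfMap K k (z ∘ Prod.map Sum.inr id) j := by
  rw [system_eq_rename, map_sub, MvPolynomial.eval_rename, MvPolynomial.eval_rename]
  rfl

theorem eval_jacobian_system_inl (K : Matrix (Fin N) (Fin r) ℕ) (k : ℕ) (j : Fin N)
    (z : (Fin k ⊕ Fin k) × Fin r → ℝ) (i : Fin k) (s : Fin r) :
    MvPolynomial.eval z (jacobian (system K k) j (Sum.inl i, s)) =
      halfJacobian K k (z ∘ Prod.map Sum.inl id) j (i, s) := by
  have h0 : MvPolynomial.pderiv ((Sum.inl i : Fin k ⊕ Fin k), s)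
      (MvPolynomial.rename (Prod.map Sum.inr id) (halfSystem K k j)) = 0 := by
    rw [halfSystem_rename, map_sum]
    exact Finset.sum_eq_zero fun i' _ => pderiv_gammaAt_of_ne K j (by simp) s
  rw [jacobian, Matrix.of_apply, system_eq_rename, map_sub, h0, sub_zero]
  have h1 := MvPolynomial.pderiv_rename
    (f := Prod.map (Sum.inl : Fin k → Fin k ⊕ Fin k) (id : Fin r → Fin r))
    (Sum.inl_injective.prodMap Function.injective_id) (i, s) (halfSystem K k j)
  rw [Prod.map_apply, id] at h1
  rw [h1, MvPolynomial.eval_rename]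
  rfl

theorem eval_jacobian_system_inr (K : Matrix (Fin N) (Fin r) ℕ) (k : ℕ) (j : Fin N)
    (z : (Fin k ⊕ Fin k) × Fin r → ℝ) (i : Fin k) (s : Fin r) :
    MvPolynomial.eval z (jacobian (system K k) j (Sum.inr i, s)) =
      -halfJacobian K k (z ∘ Prod.map Sum.inr id) j (i, s) := by
  have h0 : MvPolynomial.pderiv ((Sum.inr i : Fin k ⊕ Fin k), s)
      (MvPolynomial.rename (Prod.map Sum.inl id) (halfSystem K k j)) = 0 := by
    rw [halfSystem_rename, map_sum]
    exact Finset.sum_eq_zero fun i' _ => pderiv_gammaAt_of_ne K j (by simp) s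
  rw [jacobian, Matrix.of_apply, system_eq_rename, map_sub, h0, zero_sub]
  have h1 := MvPolynomial.pderiv_rename
    (f := Prod.map (Sum.inr : Fin k → Fin k ⊕ Fin k) (id : Fin r → Fin r))
    (Sum.inr_injective.prodMap Function.injective_id) (i, s) (halfSystem K k j)
  rw [Prod.map_apply, id] at h1
  rw [h1, map_neg, MvPolynomial.eval_rename]
  rfl

/-- The minus sign of the second half of J₀ cancels in J₀·ᵗJ₀, which is therefore the sum of the
Gram matrices of the two halves. -/
theorem eval_G0 (K : Matrix (Fin N) (Fin r) ℕ) (k : ℕ) (z : (Fin k ⊕ Fin k) × Fin r → ℝ) :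
    MvPolynomial.eval z (G0 K k) =
      pairGram (halfMap K k) (z ∘ (Equiv.sumProdDistrib (Fin k) (Fin k) (Fin r)).symm) := by
  rw [G0, eval_gramDet, pairGram, jacobianMatrix_halfMap, jacobianMatrix_halfMap]
  congr 1
  ext j j'
  simp only [Matrix.mul_apply, Matrix.add_apply, Matrix.transpose_apply, Matrix.map_apply]
  rw [← (Equiv.sumProdDistrib (Fin k) (Fin k) (Fin r)).symm.sum_comp, Fintype.sum_sum_type]
  congr 1
  · refine Finset.sum_congr rfl fun p _ => ?_
    rw [Equiv.sumProdDistrib_symm_apply_left, eval_jacobian_system_inl, eval_jacobian_system_inl]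
    rfl
  · refine Finset.sum_congr rfl fun p _ => ?_
    rw [Equiv.sumProdDistrib_symm_apply_right, eval_jacobian_system_inr, eval_jacobian_system_inr,
      neg_mul_neg]
    rfl

/-- The points of the `2kr`-dimensional space both of whose halves lie in `A`. -/
def pairSet (k r : ℕ) (A : Set (Fin k × Fin r → ℝ)) :
    Set (EuclideanSpace ℝ ((Fin k ⊕ Fin k) × Fin r)) :=
  {z | (fun p : Fin k × Fin r => z (Sum.inl p.1, p.2)) ∈ A ∧
    (fun p : Fin k × Fin r => z (Sum.inr p.1, p.2)) ∈ A}

theorem preimage_fiberProduct_halfMap (K : Matrix (Fin N) (Fin r) ℕ) (k : ℕ)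
    {A : Set (Fin k × Fin r → ℝ)} (hA : A ⊆ Set.Icc 0 1) :
    (LinearIsometryEquiv.piLpCongrLeft 2 ℝ ℝ
      (Equiv.sumProdDistrib (Fin k) (Fin k) (Fin r))) ⁻¹'
        (WithLp.toLp 2 '' fiberProduct (halfMap K k) A A) = PiSet K k ∩ pairSet k r A := by
  ext z
  have hmem : ∀ y : EuclideanSpace ℝ (Fin k × Fin r ⊕ Fin k × Fin r),
      y ∈ WithLp.toLp 2 '' fiberProduct (halfMap K k) A A ↔
        y.ofLp ∈ fiberProduct (halfMap K k) A A := fun y =>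
    ⟨by rintro ⟨w, hw, rfl⟩; exact hw, fun h => ⟨y.ofLp, h, rfl⟩⟩
  have hsys : ∀ j, MvPolynomial.eval (fun p => z p) (system K k j) =
      halfMap K k (fun p : Fin k × Fin r => z (Sum.inl p.1, p.2)) j -
        halfMap K k (fun p : Fin k × Fin r => z (Sum.inr p.1, p.2)) j :=
    fun j => eval_system K k j _
  rw [Set.mem_preimage, hmem]
  constructor
  · rintro ⟨h1, h2, h3⟩
    refine ⟨⟨?_, fun j => ?_⟩, h1, h2⟩
    · rintro ⟨i | i, s⟩
      · exact ⟨(hA h1).1 (i, s), (hA h1).2 (i, s)⟩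
      · exact ⟨(hA h2).1 (i, s), (hA h2).2 (i, s)⟩
    · rw [hsys, sub_eq_zero]
      exact congrFun h3 j
  · rintro ⟨⟨-, h1⟩, h2, h3⟩
    refine ⟨h2, h3, funext fun j => ?_⟩
    have := h1 j
    rwa [hsys, sub_eq_zero] at this

theorem exists_density_surface (K : Matrix (Fin N) (Fin r) ℕ) {k : ℕ} (hN : N ≤ k * r)
    {A : Set (Fin k × Fin r → ℝ)} (hA : A ⊆ Set.Icc 0 1) (hAm : MeasurableSet A)
    (hPhi : ∀ x ∈ A, MvPolynomial.eval x (Phi K k 1) ≠ 0) :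
    ∃ f : (Fin N → ℝ) → ℝ≥0∞, Measurable f ∧
      (volume.restrict A).map (halfMap K k) = volume.withDensity f ∧
      ∫⁻ z in PiSet K k ∩ pairSet k r A,
        ENNReal.ofReal (1 / √(MvPolynomial.eval (fun p => z p) (G0 K k))) ∂μHE[2 * k * r - N] =
      ∫⁻ t, f t ^ 2 := by
  obtain ⟨f, hf, hmap, hint⟩ := exists_density_lintegral_fiberProduct (σ := Fin k × Fin r)
    (by simpa using hN) (contDiff_halfMap K k) hAm fun x hx => surjective_fderiv_halfMap (hPhi x hx)
  refine ⟨f, hf, hmap, ?_⟩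
  rw [← hint, ← preimage_fiberProduct_halfMap K k hA]
  set e := LinearIsometryEquiv.piLpCongrLeft 2 ℝ ℝ (Equiv.sumProdDistrib (Fin k) (Fin k) (Fin r))
  have hd : 2 * Fintype.card (Fin k × Fin r) - N = 2 * k * r - N := by simp [mul_assoc]
  rw [hd, ← (e.toIsometryEquiv.measurePreserving_euclideanHausdorffMeasure
    (2 * k * r - N)).setLIntegral_comp_preimage_emb e.toHomeomorph.measurableEmbedding]
  refine lintegral_congr fun z => ?_
  rw [eval_G0]
  rfl

/-- The points of the cube at which all `Φⱼ`, `j ∈ J`, are positive. -/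
def positiveSet (K : Matrix (Fin N) (Fin r) ℕ) (k : ℕ) (J : Finset ℕ) :
    Set (Fin k × Fin r → ℝ) :=
  {x | x ∈ Set.Icc 0 1 ∧ ∀ j ∈ J, 0 < MvPolynomial.eval x (Phi K k j)}

theorem measurableSet_positiveSet (K : Matrix (Fin N) (Fin r) ℕ) (k : ℕ) (J : Finset ℕ) :
    MeasurableSet (positiveSet K k J) := by
  have : positiveSet K k J = Set.Icc 0 1 ∩ ⋂ j ∈ J, {x | 0 < MvPolynomial.eval x (Phi K k j)} := by
    ext x; simp [positiveSet]
  rw [this]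
  exact measurableSet_Icc.inter (J.measurableSet_biInter fun j _ =>
    (isOpen_lt continuous_const (MvPolynomial.continuous_eval _)).measurableSet)

/-- Gram determinants are nonnegative, so positivity fails only on the null zero sets. -/
theorem positiveSet_ae_eq {K : Matrix (Fin N) (Fin r) ℕ} {k : ℕ} {J : Finset ℕ}
    (hJ : ∀ j ∈ J, Phi K k j ≠ 0) :
    positiveSet K k J =ᵐ[volume] (Set.Icc 0 1 : Set (Fin k × Fin r → ℝ)) := by
  have h : ∀ᵐ x : Fin k × Fin r → ℝ, ∀ j ∈ J, MvPolynomial.eval x (Phi K k j) ≠ 0 := by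
    rw [Filter.eventually_all_finset]
    intro j hj
    rw [ae_iff]
    simpa using volume_zeros_eq_zero (hJ j hj)
  filter_upwards [h] with x hx
  refine propext ⟨fun h => h.1, fun h => ⟨h, fun j hj => ?_⟩⟩
  exact lt_of_le_of_ne (eval_Phi_nonneg K k j x) (hx j hj).symm

theorem D_antitone (K : Matrix (Fin N) (Fin r) ℕ) (k : ℕ) (J : Finset ℕ) :
    Antitone (D K k J) := fun _ _ h _ hx => ⟨hx.1, fun j hj => h.trans (hx.2 j hj)⟩

theorem DProd_antitone (K : Matrix (Fin N) (Fin r) ℕ) (k : ℕ) (J : Finset ℕ) :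
    Antitone (DProd K k J) := fun _ _ h _ hz =>
  ⟨D_antitone K k J h hz.1, D_antitone K k J h hz.2⟩

theorem exists_mem_D_of_mem_positiveSet {K : Matrix (Fin N) (Fin r) ℕ} {k : ℕ} {J : Finset ℕ}
    {x : Fin k × Fin r → ℝ} (hx : x ∈ positiveSet K k J) :
    ∀ᶠ lam in 𝓝[>] (0 : ℝ), x ∈ D K k J lam := by
  have h : ∀ᶠ lam in 𝓝[>] (0 : ℝ), ∀ j ∈ J, lam ≤ MvPolynomial.eval x (Phi K k j) := by
    rw [Filter.eventually_all_finset]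
    intro j hj
    exact nhdsWithin_le_nhds (eventually_le_nhds (hx.2 j hj))
  filter_upwards [h] with lam hlam using ⟨hx.1, hlam⟩

/-- The domains increase as λ decreases. Monotonicity gives a limit along all λ → 0+, and monotone
convergence along one sequence identifies it. -/
theorem tendsto_surfaceIntegral_positiveSet (K : Matrix (Fin N) (Fin r) ℕ) (k : ℕ)
    (J : Finset ℕ) :
    Tendsto (fun lam : ℝ => surfaceIntegral K k J lam) (𝓝[>] 0)
      (𝓝 (∫⁻ z in PiSet K k ∩ pairSet k r (positiveSet K k J),
        ENNReal.ofReal (1 / √(MvPolynomial.eval (fun p => z p) (G0 K k)))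
          ∂μHE[2 * k * r - N])) := by
  have hanti : Antitone (surfaceIntegral K k J) := fun a b h =>
    lintegral_mono_set (Set.inter_subset_inter_right _ (DProd_antitone K k J h))
  obtain ⟨u, hu, hu0, hulim⟩ := exists_seq_strictAnti_tendsto (0 : ℝ)
  have hlim : Tendsto u atTop (𝓝[>] 0) :=
    tendsto_nhdsWithin_iff.2 ⟨hulim, Eventually.of_forall hu0⟩
  have hunion : PiSet K k ∩ pairSet k r (positiveSet K k J) =
      ⋃ n, PiSet K k ∩ DProd K k J (u n) := by
    rw [← Set.inter_iUnion]
    congr 1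
    ext z
    rw [Set.mem_iUnion]
    constructor
    · rintro ⟨h1, h2⟩
      exact (hlim.eventually ((exists_mem_D_of_mem_positiveSet h1).and
        (exists_mem_D_of_mem_positiveSet h2))).exists
    · rintro ⟨n, h1, h2⟩
      exact ⟨⟨h1.1, fun j hj => (hu0 n).trans_le (h1.2 j hj)⟩,
        ⟨h2.1, fun j hj => (hu0 n).trans_le (h2.2 j hj)⟩⟩
  have hmono : Monotone fun n => PiSet K k ∩ DProd K k J (u n) := fun m n h =>
    Set.inter_subset_inter_right _ (DProd_antitone K k J (hu.antitone h))
  have hconv := hanti.tendsto_nhdsGT 0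
  have hseq : Tendsto (fun n => surfaceIntegral K k J (u n)) atTop
      (𝓝 (⨆ n, surfaceIntegral K k J (u n))) :=
    tendsto_atTop_iSup fun m n h => hanti (hu.antitone h)
  rw [hunion, setLIntegral_iUnion_of_directed _ hmono.directed_le]
  have := tendsto_nhds_unique (hconv.comp hlim) hseq
  rw [this] at hconv
  exact hconv

/-- Removing a null set from the cube does not change the image measure, so the density built on the
positive set also computes θ_k. -/
theorem tendsto_surfaceIntegral {K : Matrix (Fin N) (Fin r) ℕ} {k : ℕ} {J : Finset ℕ}
    (hN : N ≤ k * r)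
    (hpos : ∀ x ∈ positiveSet K k J, MvPolynomial.eval x (Phi K k 1) ≠ 0)
    (hJ : ∀ j ∈ J, Phi K k j ≠ 0) :
    Tendsto (fun lam : ℝ => surfaceIntegral K k J lam) (𝓝[>] 0) (𝓝 (theta K k)) := by
  obtain ⟨f, hf, hmap, hint⟩ := exists_density_surface K hN (fun x hx => hx.1)
    (measurableSet_positiveSet K k J) hpos
  rw [Measure.restrict_congr_set (positiveSet_ae_eq hJ)] at hmap
  rw [theta_eq_lintegral_sq K k hf hmap, ← hint]
  exact tendsto_surfaceIntegral_positiveSet K k J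

end SurfaceIntegral

end Terry

theorem lemma3 {N r : ℕ} (K : Matrix (Fin N) (Fin r) ℕ)
    (hK : ∀ j, 0 < ∑ s, K j s)
    (hord : Terry.NLOrdered K)
    (ρ : ℕ) (hrank : (Terry.realMatrix K).rank = ρ) (hρ : 1 ≤ ρ)
    {q : ℕ} (str : Fin q → ℕ) (hstr : Terry.HasStructure K str)
    (k : ℕ) (hkρ : N ≤ k * ρ) (hkq : q ≤ k) :
    Tendsto (fun lam : ℝ => Terry.surfaceIntegral K k {1} lam) (𝓝[>] 0)
        (𝓝 (Terry.theta K k)) ∧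
    (Terry.SeniorFormContainsAll K →
      Tendsto (fun lam : ℝ =>
          Terry.surfaceIntegral K k (Finset.Icc 1 (Terry.degree K - 1)) lam) (𝓝[>] 0)
        (𝓝 (Terry.theta K k))) := by
  have hone : Terry.Phi K k 1 ≠ 0 := Terry.Phi_one_ne_zero hord hstr hkq
  have hN : N ≤ k * r := by
    refine hkρ.trans (Nat.mul_le_mul_left k ?_)
    rw [← hrank]
    simpa using (Terry.realMatrix K).rank_le_card_width
  refine ⟨Terry.tendsto_surfaceIntegral hN (fun x hx => (hx.2 1 (by simp)).ne') (by simpa using hone),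
    fun hsen => Terry.tendsto_surfaceIntegral hN (fun x hx => ?_) fun j hj => ?_⟩
  · by_cases hdeg : 2 ≤ Terry.degree K
    · exact (hx.2 1 (Finset.mem_Icc.2 ⟨le_rfl, by omega⟩)).ne'
    -- In degree at most one the index set is empty. Every row then has sum 1, so Φ_1 is constant,
    -- and nonzero at one point means nonzero everywhere.
    · have hK1 : ∀ j, ∑ s, K j s = 1 := fun j => by
        have h1 : ∑ s, K j s ≤ Terry.degree K :=
          Finset.le_sup (f := fun j => ∑ s, K j s) (Finset.mem_univ j)
        have := hK j
        omega
      obtain ⟨y, hy⟩ : ∃ y, MvPolynomial.eval y (Terry.Phi K k 1) ≠ 0 := by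
        by_contra! h
        exact hone (MvPolynomial.funext fun y => by rw [h y, map_zero])
      have hJ : Terry.halfJacobian K k x = Terry.halfJacobian K k y := by
        ext j ⟨i, s⟩
        rw [Terry.halfJacobian_of_degree_one hK1, Terry.halfJacobian_of_degree_one hK1]
      rwa [Terry.eval_Phi_one, hJ, ← Terry.eval_Phi_one]
  · rw [Finset.mem_Icc] at hj
    rcases j with _ | _ | l
    · omega
    · exact hone
    · exact Terry.Phi_higher_ne_zero hsen k (by omega)
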